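/- Let $K$ be a field of characteristic $0$ (for instance $\mathbb C(t)$), let $t\in K$, let $M_1,M_2,N\ge 0$ be integers, and let $u_1,\dots,u_N\in K$ be nonzero with $u_j^2\neq u_k^2$ for $j\ne k$. *Model.* Let $\hat{\mathcal F}$ be the $K$-vector space with basis $\bigotimes_{i=1}^{M_1}|n_i\rangle^{(1)}_i\otimes\bigotimes_{i=1}^{M_2}|m_i\rangle^{(2)}_i$ ($n_i,m_i\ge0$), with vacuum $|0\rangle$ (all $n_i=m_i=0$). For $q=t$ let $B_i^{(s)\dagger}$ and $B_i^{(s)}$ act on the $i$-th factor of the $s$-th site by $B^\dagger|n\rangle=|n+1\rangle$, $B|n\rangle=[n]\,|n-1\rangle$, $B|0\rangle=0$, where $[n]=1+q+\dots+q^{n-1}$. Put $$L^{(s)}_i(u)=\begin{pmatrix}u^{-1}&B_i^{(s)\dagger}\\(1-q)B_i^{(s)}&u\end{pmatrix}\ (1\le i\le M_s),\qquad L^{(s)}_0(u)=\begin{pmatrix}u^{-1}&1\\1&u\end{pmatrix}$$ (the zero energy level is forgotten: $B_0^{(s)\dagger}$ and $(1-q)B_0^{(s)}$ are replaced by $1$),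 let $$T(u)=\begin{pmatrix}A(u)&B(u)\\C(u)&D(u)\end{pmatrix}=L^{(2)}_{M_2}(u)\cdots L^{(2)}_0(u)\,L^{(1)}_{M_1}(u)\cdots L^{(1)}_0(u)$$ and $|\Psi_N(u_1,\dots,u_N)\rangle=B(u_1)\cdots B(u_N)|0\rangle$. *Symmetric functions.* For a partition $\lambda$ with at most $n$ rows, $P_\lambda(x_1,\dots,x_n)$ is the Hall–Littlewood polynomial $\sum_{w\in S_n/S_n^\lambda}w\big(x_1^{\lambda_1}\cdots x_n^{\lambda_n}\prod_{\lambda_i>\lambda_j}\frac{x_i-tx_j}{x_i-x_j}\big)$. Let $q_n(\mathbf x)$ be given by $\sum_{n\ge0} q_n(\mathbf x)z^n=\exp\big(\sum_{n\ge1}(1-t^n)x_nz^n\big)$, with $q_n=0$ for $n<0$. For $\lambda=(\lambda_1,\dots,\lambda_l)$ and $\mu=(\mu_1,\dots,\mu_{l'})$ the coupled Hall–Littlewood function in $K[\mathbf x,\mathbf y]=K[x_1,x_2,\dots,y_1,y_2,\dots]$ is $$Q_{[\lambda,\mu]}(\mathbf x,\mathbf y)=\prod_{i<j}\frac{1-R_{\lambda_i\lambda_j}}{1-tR_{\lambda_i\lambda_j}}\prod_{a<b}\frac{1-R_{\mu_a\mu_b}}{1-tR_{\mu_a\mu_b}}\prod_{i,a}\frac{(1-D_{\lambda_i\mu_a})(1-t^2D_{\lambda_i\mu_a})}{(1-tD_{\lambda_i\mu_a})^2}\;q_{\lambda_1}(\mathbf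 x)\cdots q_{\lambda_l}(\mathbf x)\,q_{\mu_1}(\mathbf y)\cdots q_{\mu_{l'}}(\mathbf y),$$ expanded in powers of the operators, which act on the indices: $R_{\lambda_i\lambda_j}$ replaces $(\lambda_i,\lambda_j)$ by $(\lambda_i+1,\lambda_j-1)$, likewise $R_{\mu_a\mu_b}$, and $D_{\lambda_i\mu_a}$ replaces $(\lambda_i,\mu_a)$ by $(\lambda_i-1,\mu_a-1)$. Write $|\lambda,\mu\rangle$ for the basis vector of $\hat{\mathcal F}$ with $\lambda=1^{n_1}2^{n_2}\cdots$ and $\mu=1^{m_1}2^{m_2}\cdots$, and let $\jmath:\hat{\mathcal F}\to K[\mathbf x,\mathbf y]$ be the linear map with $\jmath|\lambda,\mu\rangle=Q_{[\lambda,\mu]}(\mathbf x,\mathbf y)$. *Proposition.* In $\hat{\mathcal F}$, $$|\Psi_N(u_1,\dots,u_N)\rangle=(u_1\cdots u_N)^{-M_2+M_1+1}\sum_{i=0}^N\ \sum_{k_1<\dots<k_i}(u_{k_1}\cdots u_{k_i})^{-2M_1-2}\prod_{k\in\{k_1,\dots,k_i\}}\ \prod_{j\notin\{k_1,\dots,k_i\}}\frac{u_j^2-tu_k^2}{u_j^2-u_k^2}\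 \sum_{\lambda,\mu}P_\lambda(u_{k_1}^2,\dots,u_{k_i}^2)\,P_\mu(u_1^2,\dots,u_N^2)\,|\lambda,\mu\rangle,$$ where the second sum is over subsets $\{k_1<\dots<k_i\}$ of $\{1,\dots,N\}$, $\lambda$ runs over the Young diagrams with at most $i$ rows and at most $M_1$ columns, and $\mu$ over the Young diagrams with at most $N$ rows and at most $M_2$ columns. Consequently $\jmath|\Psi_N(u_1,\dots,u_N)\rangle$ is given by the same formula with $|\lambda,\mu\rangle$ replaced by $Q_{[\lambda,\mu]}(\mathbf x,\mathbf y)$. -/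

import Mathlib

noncomputable section

namespace QBoson

/-! ## The algebra of coupled Hall-Littlewood functions -/

/-- The polynomial ring `K[x, y]` in the variables `x_n = X (Sum.inl n)` and
`y_n = X (Sum.inr n)`, `n ≥ 1`. -/
abbrev XY (K : Type*) [Field K] : Type _ := MvPolynomial (ℕ+ ⊕ ℕ+) K

/-- The series `ξ_t(v, z) = ∑_{n ≥ 1} (1 - t ^ n) v_n z ^ n` in the variable `z`. -/
def xi {K : Type*} [Field K] (t : K) (v : ℕ+ → XY K) : PowerSeries (XY K) :=
  PowerSeries.mk fun n => if h : 0 < n then (1 - t ^ n) • v ⟨n, h⟩ else 0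

/-- `q_n(v)`: the coefficient of `z ^ n` in `exp (ξ_t(v, z))`, and `0` for `n < 0`. -/
def qFun {K : Type*} [Field K] [CharZero K] (t : K) (v : ℕ+ → XY K) (n : ℤ) : XY K :=
  if 0 ≤ n then PowerSeries.coeff n.toNat ((PowerSeries.exp K).subst (xi t v)) else 0

/-- The expansion of `(1 - R) / (1 - t R)` in powers of `R`. -/
def raisingSeries {K : Type*} [Field K] (t : K) : PowerSeries K :=
  (1 - PowerSeries.X) * (1 - PowerSeries.C t * PowerSeries.X)⁻¹

/-- The expansion of `((1 - D) / (1 - t D)) * ((1 - t ^ 2 D) / (1 - t D))` in powers of `D`. -/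
def loweringSeries {K : Type*} [Field K] (t : K) : PowerSeries K :=
  ((1 - PowerSeries.X) * (1 - PowerSeries.C t * PowerSeries.X)⁻¹) *
    ((1 - PowerSeries.C (t ^ 2) * PowerSeries.X) * (1 - PowerSeries.C t * PowerSeries.X)⁻¹)

/-- The pairs `i < j` of row indices. -/
abbrev Pairs (l : ℕ) : Type := {p : Fin l × Fin l // p.1 < p.2}

/-- The `i`-th entry of the integer sequence obtained from `lam` by applying `∏ R_{ij} ^ r_{ij}`
(each `R_{ij}` adds `1` to entry `i` and subtracts `1` from entry `j`) and then subtracting `e i`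
from entry `i`. -/
def shifted (lam : List ℕ) (r : Pairs lam.length → ℕ) (e : Fin lam.length → ℕ)
    (i : Fin lam.length) : ℤ :=
  (lam.get i : ℤ) + (∑ p : Pairs lam.length, if p.1.1 = i then (r p : ℤ) else 0)
    - (∑ p : Pairs lam.length, if p.1.2 = i then (r p : ℤ) else 0) - e i

/-- Exponents of the operators `R_{λ_i λ_j}` (`i < j`), `R_{μ_a μ_b}` (`a < b`), `D_{λ_i μ_a}`. -/
abbrev Exponents (lam mu : List ℕ) : Type :=
  (Pairs lam.length → ℕ) × (Pairs mu.length → ℕ) × (Fin lam.length × Fin mu.length → ℕ)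

/-- The contribution to `Q_{[λ,μ]}` of one monomial in the operators `R` and `D`. -/
def coupledQTerm {K : Type*} [Field K] [CharZero K] (t : K) (lam mu : List ℕ)
    (w : Exponents lam mu) : XY K :=
  ((∏ p, PowerSeries.coeff (w.1 p) (raisingSeries t)) *
      (∏ p, PowerSeries.coeff (w.2.1 p) (raisingSeries t)) *
      (∏ p, PowerSeries.coeff (w.2.2 p) (loweringSeries t))) •
    ((∏ i, qFun t (fun n => MvPolynomial.X (Sum.inl n))
        (shifted lam w.1 (fun i => ∑ a, w.2.2 (i, a)) i)) *
      (∏ a, qFun t (fun n => MvPolynomial.X (Sum.inr n))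
        (shifted mu w.2.1 (fun a => ∑ i, w.2.2 (i, a)) a)))

/-- The coupled Hall-Littlewood function `Q_{[λ,μ]}(x, y)`, that is
`∏_{i<j} (1-R_{λ_i λ_j})/(1-tR_{λ_i λ_j}) ∏_{a<b} (1-R_{μ_a μ_b})/(1-tR_{μ_a μ_b})
∏_{i,a} (1-D_{λ_i μ_a})(1-t^2 D_{λ_i μ_a})/(1-tD_{λ_i μ_a})^2 q_{[λ,μ]}(x, y)`,
expanded in powers of the operators. Only finitely many terms are nonzero
(`coupledQTerm_support_finite` below). -/
def coupledQ {K : Type*} [Field K] [CharZero K] (t : K) (lam mu : List ℕ) : XY K :=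
  ∑ᶠ w : Exponents lam mu, coupledQTerm t lam mu w

theorem qFun_of_neg {K : Type*} [Field K] [CharZero K] (t : K) (v : ℕ+ → XY K) {n : ℤ}
    (hn : n < 0) : qFun t v n = 0 := by
  simp [qFun, not_le.mpr hn]

theorem shifted_bound (lam : List ℕ) (r : Pairs lam.length → ℕ) (e : Fin lam.length → ℕ)
    (h : ∀ i, 0 ≤ shifted lam r e i) : (∀ p, r p ≤ lam.sum) ∧ ∀ i, e i ≤ lam.sum := by
  have hsum : (∑ i, (lam.get i : ℤ)) = (lam.sum : ℤ) := by
    rw [← Nat.cast_sum]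
    congr 1
    rw [← List.sum_ofFn, List.ofFn_get]
  have key : ∀ m : Fin lam.length,
      (∑ p : Pairs lam.length, (if p.1.1 < m ∧ m ≤ p.1.2 then (r p : ℤ) else 0))
        + ∑ i, (if m ≤ i then (e i : ℤ) else 0) ≤ lam.sum := by
    intro m
    have h1 : 0 ≤ ∑ i, (if m ≤ i then shifted lam r e i else 0) := by
      apply Finset.sum_nonneg
      intro i _
      split_ifs
      · exact h i
      · exact le_rfl
    have h2 : (∑ i, (if m ≤ i then shifted lam r e i else 0))
        = (∑ i, (if m ≤ i then (lam.get i : ℤ) else 0))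
          - (∑ p : Pairs lam.length, (if p.1.1 < m ∧ m ≤ p.1.2 then (r p : ℤ) else 0))
          - ∑ i, (if m ≤ i then (e i : ℤ) else 0) := by
      have e1 : ∀ f : Pairs lam.length → Fin lam.length,
          (∑ i, (if m ≤ i then (∑ p : Pairs lam.length, if f p = i then (r p : ℤ) else 0) else 0))
          = ∑ p : Pairs lam.length, (if m ≤ f p then (r p : ℤ) else 0) := by
        intro f
        have : ∀ i, (if m ≤ i then (∑ p : Pairs lam.length, if f p = i then (r p : ℤ) else 0) else 0)
            = ∑ p : Pairs lam.length, (if f p = i then (if m ≤ i then (r p : ℤ) else 0) else 0) := by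
          intro i
          split_ifs <;> simp
        rw [Finset.sum_congr rfl (fun i _ => this i), Finset.sum_comm]
        simp
      have e2 : (∑ p : Pairs lam.length, (if p.1.1 < m ∧ m ≤ p.1.2 then (r p : ℤ) else 0))
          = (∑ p : Pairs lam.length, (if m ≤ p.1.2 then (r p : ℤ) else 0))
            - ∑ p : Pairs lam.length, (if m ≤ p.1.1 then (r p : ℤ) else 0) := by
        rw [← Finset.sum_sub_distrib]
        apply Finset.sum_congr rfl
        rintro ⟨⟨a, b⟩, hab⟩ _
        have hab' : a < b := hab
        by_cases ha : m ≤ a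
        · have hb : m ≤ b := ha.trans hab'.le
          simp [ha, hb, not_lt.mpr ha]
        · simp [ha, not_le.mp ha]
      rw [e2, ← e1 (fun p => p.1.1), ← e1 (fun p => p.1.2), ← Finset.sum_sub_distrib,
        ← Finset.sum_sub_distrib, ← Finset.sum_sub_distrib]
      apply Finset.sum_congr rfl
      intro i _
      by_cases hi : m ≤ i
      · simp only [hi, if_true, shifted]
        ring
      · simp [hi]
    have h3 : (∑ i, (if m ≤ i then (lam.get i : ℤ) else 0)) ≤ lam.sum := by
      rw [← hsum]
      apply Finset.sum_le_sum
      intro i _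
      split_ifs
      · exact le_rfl
      · positivity
    linarith
  have n1 : ∀ m : Fin lam.length, ∀ p : Pairs lam.length,
      (0 : ℤ) ≤ (if p.1.1 < m ∧ m ≤ p.1.2 then (r p : ℤ) else 0) := by
    intro m p
    split_ifs
    · positivity
    · exact le_rfl
  have n2 : ∀ m i : Fin lam.length, (0 : ℤ) ≤ (if m ≤ i then (e i : ℤ) else 0) := by
    intro m i
    split_ifs
    · positivity
    · exact le_rfl
  constructor
  · intro p
    have a1 := key p.1.2
    have a2 := Finset.single_le_sum (fun x _ => n1 p.1.2 x) (Finset.mem_univ p)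
    have a3 : (0 : ℤ) ≤ ∑ i, (if p.1.2 ≤ i then (e i : ℤ) else 0) :=
      Finset.sum_nonneg fun i _ => n2 _ i
    rw [if_pos ⟨p.2, le_rfl⟩] at a2
    have : (r p : ℤ) ≤ lam.sum := by linarith
    exact_mod_cast this
  · intro i
    have a1 := key i
    have a2 := Finset.single_le_sum (fun x _ => n2 i x) (Finset.mem_univ i)
    have a3 : (0 : ℤ) ≤ ∑ p : Pairs lam.length,
        (if p.1.1 < i ∧ i ≤ p.1.2 then (r p : ℤ) else 0) :=
      Finset.sum_nonneg fun p _ => n1 _ p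
    rw [if_pos le_rfl] at a2
    have : (e i : ℤ) ≤ lam.sum := by linarith
    exact_mod_cast this

theorem coupledQTerm_support_finite {K : Type*} [Field K] [CharZero K] (t : K)
    (lam mu : List ℕ) : (Function.support (coupledQTerm t lam mu)).Finite := by
  apply ((Set.finite_Iic (fun _ => lam.sum : Pairs lam.length → ℕ)).prod
    ((Set.finite_Iic (fun _ => mu.sum : Pairs mu.length → ℕ)).prod
      (Set.finite_Iic (fun _ => lam.sum : Fin lam.length × Fin mu.length → ℕ)))).subset
  rintro ⟨r, s, d⟩ hw
  rw [Function.mem_support] at hw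
  have hx : ∀ i, 0 ≤ shifted lam r (fun i => ∑ a, d (i, a)) i := by
    intro i
    by_contra hi
    apply hw
    have : (∏ i, qFun t (fun n => MvPolynomial.X (Sum.inl n))
        (shifted lam r (fun i => ∑ a, d (i, a)) i)) = 0 :=
      Finset.prod_eq_zero (Finset.mem_univ i) (qFun_of_neg _ _ (not_le.mp hi))
    simp only [coupledQTerm, this, zero_mul, smul_zero]
  have hy : ∀ a, 0 ≤ shifted mu s (fun a => ∑ i, d (i, a)) a := by
    intro a
    by_contra ha
    apply hw
    have : (∏ a, qFun t (fun n => MvPolynomial.X (Sum.inr n))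
        (shifted mu s (fun a => ∑ i, d (i, a)) a)) = 0 :=
      Finset.prod_eq_zero (Finset.mem_univ a) (qFun_of_neg _ _ (not_le.mp ha))
    simp only [coupledQTerm, this, mul_zero, smul_zero]
  have bx := shifted_bound _ _ _ hx
  have byy := shifted_bound _ _ _ hy
  refine ⟨fun p => bx.1 p, fun p => byy.1 p, fun p => ?_⟩
  exact (Finset.single_le_sum (f := fun a => d (p.1, a)) (fun _ _ => Nat.zero_le _)
    (Finset.mem_univ p.2)).trans (bx.2 p.1)

/-! ## Young diagrams and Hall-Littlewood polynomials `P_λ` -/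

theorem finite_box (n M : ℕ) :
    {lam : YoungDiagram | lam.colLen 0 ≤ n ∧ lam.rowLen 0 ≤ M}.Finite := by
  apply Set.Finite.of_finite_image (f := YoungDiagram.cells)
  · apply ((Finset.range n ×ˢ Finset.range M).powerset.finite_toSet).subset
    rintro _ ⟨lam, ⟨h1, h2⟩, rfl⟩
    rw [Finset.mem_coe, Finset.mem_powerset]
    rintro ⟨i, j⟩ hij
    have hij' : (i, j) ∈ lam := hij
    have a := YoungDiagram.mem_iff_lt_colLen.mp hij'
    have b := YoungDiagram.mem_iff_lt_rowLen.mp hij'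
    have c := lam.colLen_anti 0 j (Nat.zero_le _)
    have d := lam.rowLen_anti 0 i (Nat.zero_le _)
    simp only [Finset.mem_product, Finset.mem_range]
    omega
  · intro a _ b _ h
    exact YoungDiagram.ext h

/-- The Young diagrams with at most `n` rows and at most `M` columns. -/
def box (n M : ℕ) : Finset YoungDiagram := (finite_box n M).toFinset

/-- The value of the Hall-Littlewood polynomial `P_λ(x_1, ..., x_n; t)` at pairwise distinct `x_i`:
`∑ w (x_1 ^ λ_1 ... x_n ^ λ_n ∏_{λ_i > λ_j} (x_i - t x_j) / (x_i - x_j))`, the sum being over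
`w ∈ S_n / S_n^λ`, i.e. over the distinct rearrangements `α` of `(λ_1, ..., λ_n)`. As usual it is
`0` if `λ` has more than `n` rows. -/
def hallLittlewoodP {K : Type*} [Field K] (t : K) {n : ℕ} (x : Fin n → K)
    (lam : YoungDiagram) : K :=
  if lam.colLen 0 ≤ n then
    ∑ α ∈ Finset.univ.image
        (fun (w : Equiv.Perm (Fin n)) (i : Fin n) => lam.rowLen (w i)),
      (∏ i, x i ^ α i) *
        ∏ i, ∏ j, if α j < α i then (x i - t * x j) / (x i - x j) else 1
  else 0

/-! ## The two-site generalized `q`-boson model -/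

/-- The energy levels `1, ..., M₁` of the first site and `1, ..., M₂` of the second site (level
`i + 1` is represented by `i`). -/
abbrev Level (M₁ M₂ : ℕ) : Type := Fin M₁ ⊕ Fin M₂

/-- The tensor product of the Fock spaces of the positive energy levels (zero energy states are
forgotten), with basis `⨂ |n_i⟩^{(1)} ⨂ |m_i⟩^{(2)}` indexed by the occupation numbers. -/
abbrev Fock (K : Type*) [Field K] (M₁ M₂ : ℕ) : Type _ := (Level M₁ M₂ → ℕ) →₀ K

/-- `[n] = (1 - q ^ n) / (1 - q) = 1 + q + ... + q ^ (n - 1)`. -/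
def qNum {K : Type*} [Field K] (q : K) (n : ℕ) : K := ∑ i ∈ Finset.range n, q ^ i

/-- `B†` at the level `i`: `|n⟩ ↦ |n + 1⟩`. -/
def create (K : Type*) [Field K] {M₁ M₂ : ℕ} (i : Level M₁ M₂) :
    Module.End K (Fock K M₁ M₂) :=
  Finsupp.lsum K fun n => Finsupp.lsingle (Function.update n i (n i + 1))

/-- `B` at the level `i`: `|n⟩ ↦ [n] |n - 1⟩` and `|0⟩ ↦ 0`. -/
def annihilate {K : Type*} [Field K] (q : K) {M₁ M₂ : ℕ} (i : Level M₁ M₂) :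
    Module.End K (Fock K M₁ M₂) :=
  Finsupp.lsum K fun n => qNum q (n i) • Finsupp.lsingle (Function.update n i (n i - 1))

/-- The `L`-matrix with entries `u⁻¹`, `bdag` (first row) and `c`, `u` (second row). -/
def lMatrix {K : Type*} [Field K] {M₁ M₂ : ℕ} (u : K)
    (bdag c : Module.End K (Fock K M₁ M₂)) : Matrix (Fin 2) (Fin 2) (Module.End K (Fock K M₁ M₂)) :=
  !![u⁻¹ • 1, bdag; c, u • 1]

/-- The monodromy matrix `L_M(u) ⋯ L_1(u) L_0(u)` of one site, where `level i` is the level of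
energy `i + 1`. For `i ≥ 1` the entries of `L_i(u)` are `u⁻¹`, `B_i†`, `(1 - q) B_i`, `u`. The zero
energy level is forgotten, that is, `B_0†` and `(1 - q) B_0` act as the identity. -/
def siteMonodromy {K : Type*} [Field K] (q : K) {M₁ M₂ : ℕ} {M : ℕ}
    (level : Fin M → Level M₁ M₂) (u : K) :
    Matrix (Fin 2) (Fin 2) (Module.End K (Fock K M₁ M₂)) :=
  (List.ofFn fun i : Fin M =>
      lMatrix u (create K (level i)) ((1 - q) • annihilate q (level i))).reverse.prod *
    lMatrix u 1 1

/-- The monodromy matrix `T(u) = T₂(u) T₁(u)` of the two-site model. -/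
def monodromy {K : Type*} [Field K] (q : K) (M₁ M₂ : ℕ) (u : K) :
    Matrix (Fin 2) (Fin 2) (Module.End K (Fock K M₁ M₂)) :=
  siteMonodromy q (Sum.inr : Fin M₂ → Level M₁ M₂) u *
    siteMonodromy q (Sum.inl : Fin M₁ → Level M₁ M₂) u

/-- The operator `B(u)`, the upper right entry of `T(u)`. -/
def opB {K : Type*} [Field K] (q : K) (M₁ M₂ : ℕ) (u : K) : Module.End K (Fock K M₁ M₂) :=
  monodromy q M₁ M₂ u 0 1

/-- The vacuum vector `|0⟩`. -/
def vacuum (K : Type*) [Field K] (M₁ M₂ : ℕ) : Fock K M₁ M₂ := Finsupp.single 0 1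

/-- The vector `|Ψ_N(u_1, ..., u_N)⟩ = B(u_1) ⋯ B(u_N) |0⟩`. -/
def betheVector {K : Type*} [Field K] (q : K) (M₁ M₂ : ℕ) {N : ℕ} (u : Fin N → K) :
    Fock K M₁ M₂ :=
  (List.ofFn fun j => opB q M₁ M₂ (u j)).prod (vacuum K M₁ M₂)

/-- The occupation numbers with `λ = 1^{n_1} 2^{n_2} ...` and `μ = 1^{m_1} 2^{m_2} ...`. -/
def occupation (M₁ M₂ : ℕ) (lam mu : YoungDiagram) : Level M₁ M₂ → ℕ :=
  Sum.elim (fun i : Fin M₁ => lam.rowLens.count ((i : ℕ) + 1))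
    (fun i : Fin M₂ => mu.rowLens.count ((i : ℕ) + 1))

/-- The basis vector `⨂ |n_i⟩^{(1)} ⨂ |m_i⟩^{(2)}` with `λ = 1^{n_1} 2^{n_2} ...` and
`μ = 1^{m_1} 2^{m_2} ...`. -/
def ket (K : Type*) [Field K] (M₁ M₂ : ℕ) (lam mu : YoungDiagram) : Fock K M₁ M₂ :=
  Finsupp.single (occupation M₁ M₂ lam mu) 1

/-- The rows, in weakly decreasing order, of the partition `1^{n_1} 2^{n_2} ... M^{n_M}`. -/
def rowsOfOccupation {M : ℕ} (n : Fin M → ℕ) : List ℕ :=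
  (List.ofFn fun i : Fin M => List.replicate (n i) ((i : ℕ) + 1)).reverse.flatten

/-- The linear map `ȷ`, `⨂ |n_i⟩^{(1)} ⨂ |m_i⟩^{(2)} ↦ Q_{[λ,μ]}` with `λ = 1^{n_1} 2^{n_2} ...`,
`μ = 1^{m_1} 2^{m_2} ...`, for `q = t`. -/
def jmap {K : Type*} [Field K] [CharZero K] (t : K) (M₁ M₂ : ℕ) :
    Fock K M₁ M₂ →ₗ[K] XY K :=
  Finsupp.linearCombination K fun n =>
    coupledQ t (rowsOfOccupation fun i => n (Sum.inl i)) (rowsOfOccupation fun i => n (Sum.inr i))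

/-- For a set `k = {k_1 < ... < k_i}` of indices, the scalar
`(u_1 ⋯ u_N)^{-M₂+M₁+1} (u_{k_1} ⋯ u_{k_i})^{-2M₁-2} ∏ (u_j^2 - t u_k^2) / (u_j^2 - u_k^2)`,
the last product being over `k` in the set and `j` outside of it, times
`P_λ(u_{k_1}^2, ..., u_{k_i}^2) P_μ(u_1^2, ..., u_N^2)`. -/
def coefficient {K : Type*} [Field K] (t : K) (M₁ M₂ : ℕ) {N : ℕ} (u : Fin N → K)
    (k : Finset (Fin N)) (lam mu : YoungDiagram) : K :=
  (∏ j, u j) ^ (-(M₂ : ℤ) + M₁ + 1) * (∏ l ∈ k, u l) ^ (-2 * (M₁ : ℤ) - 2) *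
    (∏ l ∈ k, ∏ j ∈ kᶜ, (u j ^ 2 - t * u l ^ 2) / (u j ^ 2 - u l ^ 2)) *
    hallLittlewoodP t (fun s : Fin k.card => u (k.orderEmbOfFin rfl s) ^ 2) lam *
    hallLittlewoodP t (fun j => u j ^ 2) mu

end QBoson

end

/-! This is an algebraic Bethe ansatz in the variable x = u². Both columns of `L_0(u)` are multiples
of (1, u)ᵗ, so a one-site monodromy matrix is determined by one column, that is, by two operators
α(x), δ(x), and B(u) = u^(-(M₁+M₂+1)) α₂(x) (α₁(x) + x δ₁(x)). The α's commute, the δ's commute, and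
moving δ past α satisfies a six-vertex type exchange relation; these relations survive adding an
energy level (`ExchangeRel.step`), hence hold for every site.

Let v be an eigenvector of every δ(z), with eigenvalue d(z), and let y commute with all α and δ. The
key expansion, `prod_alpha_add_delta`, writes ∏ (α(x_j) + x_j y δ(x_j)) v as a sum over subsets k of
the indices: those in k keep α, and each j outside k contributes x_j d(x_j) y and the factors (x_j -
t x_i)/(x_j - x_i), i ∈ k. The unwanted terms produced by moving δ to the right are resummed by the
partial fraction identity `sum_scatter`.

It is used in two ways. With y the creation operator of the highest level of a site, it peels that
level off: the indices outside k are those whose part is maximal. Iterating gives the monomials of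
the Hall-Littlewood polynomials, so ∏ α(x_j) on empty levels is ∑ P_λ |λ⟩ (`prodVec_chain`,
`sum_compWeight`). With y = 1, it expands the factors α₁ + x δ₁ of the first site and yields the sum
over subsets in the theorem. The second site then contributes P_μ in all the variables, and the
image under ȷ follows by linearity. -/

namespace QBoson

/-! ### Exchange relations and their stability under adding a level -/

section Exchange

variable {K A : Type*} [Field K] [Ring A] [Algebra K A]

/-- The exchange relations of two families of operators `α(x)`, `δ(x)`. -/
structure ExchangeRel (t : K) (α δ : K → A) : Prop where
  comm_α : ∀ x y, Commute (α x) (α y)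
  comm_δ : ∀ x y, Commute (δ x) (δ y)
  exch : ∀ x y, (x - y) • (δ x * α y) = (x - t * y) • (α y * δ x) - ((1 - t) * y) • (α x * δ y)

namespace ExchangeRel

variable {t : K} {α δ : K → A}

/-- The symmetry in x and y of the mixed term in a product of two enlarged operators; it makes the
new α's, and the new δ's, commute. For x ≠ y it comes from adding multiples of the exchange relation
and its mirror image. -/
theorem cross (h : ExchangeRel t α δ) (x y : K) :
    x • (δ x * α y) + y • (α x * δ y) = y • (δ y * α x) + x • (α y * δ x) := by
  by_cases hxy : x = y
  · subst hxy; rfl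
  apply smul_right_injective A (sub_ne_zero.mpr hxy)
  simp only
  linear_combination (norm := module) x • h.exch x y + y • h.exch y x

/-- The exchange relation solved for α δ instead of δ α, with the factor t kept on the left so that
t = 0 is allowed. -/
theorem cross' (h : ExchangeRel t α δ) (x y : K) :
    (t * (x - y)) • (α x * δ y) = (x - t * y) • (δ y * α x) - ((1 - t) * x) • (δ x * α y) := by
  by_cases hxy : x = y
  · subst hxy
    rw [← sub_smul]
    have := h.cross x x
    by_cases ht : (x - t * x - (1 - t) * x) = 0
    · simp [ht]
    · exact absurd (by ring) ht
  apply smul_right_injective A (sub_ne_zero.mpr hxy)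
  simp only
  linear_combination (norm := module) (x - t * y) • h.exch y x + ((1 - t) * x) • h.exch x y

/-- Left multiplication of the column (α, δ) by one more `L`-matrix with entries b = B† and c = (1 -
t) B, after rescaling by powers of u. Expanding and moving b to the left, commutativity reduces to
`cross`, and the exchange relation to x times the old one plus y times b c `cross'`. -/
theorem step (h : ExchangeRel t α δ) {b c : A} (hbα : ∀ x, Commute b (α x))
    (hbδ : ∀ x, Commute b (δ x)) (hcα : ∀ x, Commute c (α x)) (hcδ : ∀ x, Commute c (δ x))
    (hcb : c * b = t • (b * c) + (1 - t) • 1) :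
    ExchangeRel t (fun x => α x + x • (b * δ x)) (fun x => c * α x + x • δ x) := by
  have mb : ∀ x (z : A), α x * (b * z) = b * (α x * z) := fun x z => by
    rw [← mul_assoc, ← (hbα x).eq, mul_assoc]
  have nb : ∀ x (z : A), δ x * (b * z) = b * (δ x * z) := fun x z => by
    rw [← mul_assoc, ← (hbδ x).eq, mul_assoc]
  have mc : ∀ x (z : A), α x * (c * z) = c * (α x * z) := fun x z => by
    rw [← mul_assoc, ← (hcα x).eq, mul_assoc]
  have nc : ∀ x (z : A), δ x * (c * z) = c * (δ x * z) := fun x z => by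
    rw [← mul_assoc, ← (hcδ x).eq, mul_assoc]
  have cb : ∀ z : A, c * (b * z) = t • (b * (c * z)) + (1 - t) • z := fun z => by
    rw [← mul_assoc, hcb, add_mul, smul_mul_assoc, smul_mul_assoc, one_mul, mul_assoc]
  have eα : ∀ x y, (α x + x • (b * δ x)) * (α y + y • (b * δ y)) = α x * α y +
      b * (x • (δ x * α y) + y • (α x * δ y)) + (x * y) • (b * (b * (δ x * δ y))) := by
    intro x y
    simp only [add_mul, mul_add, smul_mul_assoc, mul_smul_comm, mul_assoc, mb, nb]
    module
  have eδ : ∀ x y, (c * α x + x • δ x) * (c * α y + y • δ y) = c * (c * (α x * α y)) +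
      c * (x • (δ x * α y) + y • (α x * δ y)) + (x * y) • (δ x * δ y) := by
    intro x y
    simp only [add_mul, mul_add, smul_mul_assoc, mul_smul_comm, mul_assoc, mc, nc]
    module
  refine ⟨fun x y => ?_, fun x y => ?_, fun x y => ?_⟩
  · have hc := h.cross x y
    change _ * _ = _ * _
    rw [eα, eα, hc, (h.comm_α x y).eq, (h.comm_δ x y).eq, mul_comm x y]
  · have hc := h.cross x y
    change _ * _ = _ * _
    rw [eδ, eδ, hc, (h.comm_α x y).eq, (h.comm_δ x y).eq, mul_comm x y]
  · have e1 : (c * α x + x • δ x) * (α y + y • (b * δ y)) = c * (α x * α y) +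
        y • (t • (b * (c * (α x * δ y))) + (1 - t) • (α x * δ y)) + x • (δ x * α y) +
        (x * y) • (b * (δ x * δ y)) := by
      simp only [add_mul, mul_add, smul_mul_assoc, mul_smul_comm, mul_assoc, mb, nb, cb]
      module
    have e2 : ∀ x y, (α y + y • (b * δ y)) * (c * α x + x • δ x) = c * (α y * α x) +
        y • (b * (c * (δ y * α x))) + x • (α y * δ x) + (x * y) • (b * (δ y * δ x)) := by
      intro x y
      simp only [add_mul, mul_add, smul_mul_assoc, mul_smul_comm, mul_assoc, mc, nc]
      module
    rw [e1, e2, e2, (h.comm_α y x).eq, (h.comm_δ y x).eq]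
    have k1 := h.exch x y
    have k2 := congrArg (fun z => b * (c * z)) (h.cross' x y)
    simp only [mul_sub, mul_smul_comm] at k2
    linear_combination (norm := module) x • k1 + y • k2

end ExchangeRel

end Exchange

/-! ### Wanted and unwanted terms in the Bethe ansatz -/

section Bethe

variable {K V ι : Type*} [Field K] [AddCommGroup V] [Module K V]

theorem pairwise_commute {α : K → Module.End K V} (hα : ∀ x y, Commute (α x) (α y)) (x : ι → K)
    (s : Finset ι) : (s : Set ι).Pairwise (Function.onFun Commute fun i => α (x i)) :=
  fun _ _ _ _ _ => hα _ _

/-- The vector `∏_{i ∈ s} α(x_i) v`, for commuting operators `α(x)`. -/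
def prodVec {α : K → Module.End K V} (hα : ∀ x y, Commute (α x) (α y)) (x : ι → K) (v : V)
    (s : Finset ι) : V :=
  s.noncommProd (fun i => α (x i)) (pairwise_commute hα x s) v

theorem prodVec_empty {α : K → Module.End K V} (hα : ∀ x y, Commute (α x) (α y)) (x : ι → K)
    (v : V) : prodVec hα x v ∅ = v := by
  simp [prodVec]

variable [DecidableEq ι]

/-- The factor `(a - t b) / (a - b)`. -/
def scatter (t a b : K) : K := (a - t * b) / (a - b)

/-- This is the partial fraction expansion in z of ∏ (x_j - t z)/(x_j - z). -/
theorem sum_scatter (t : K) {x : ι → K} (hx : Function.Injective x) (s : Finset ι) :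
    ∀ z : K, (∀ i ∈ s, x i ≠ z) →
    ∑ k ∈ s, (1 - t) * z / (z - x k) * ∏ j ∈ s.erase k, scatter t (x j) (x k) =
      1 - ∏ j ∈ s, scatter t (x j) z := by
  induction s using Finset.induction_on with
  | empty => simp
  | insert a s ha ih =>
    intro z hz
    have hs : ∀ i ∈ s, x i ≠ z := fun i hi => hz i (Finset.mem_insert_of_mem hi)
    have hsa : ∀ i ∈ s, x i ≠ x a := fun i hi h => ha (hx h ▸ hi)
    have haz : x a ≠ z := hz a (Finset.mem_insert_self _ _)
    have h1 : x a - z ≠ 0 := sub_ne_zero.mpr haz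
    have h2 : z - x a ≠ 0 := sub_ne_zero.mpr haz.symm
    rw [Finset.sum_insert ha, Finset.prod_insert ha, Finset.erase_insert ha]
    -- Splitting the poles at x_k and x_a reduces each old summand to the induction hypothesis at z
    -- and at x_a, which is why z is quantified inside the induction.
    have e : ∀ k ∈ s, (1 - t) * z / (z - x k) *
        ∏ j ∈ (insert a s).erase k, scatter t (x j) (x k) =
        scatter t (x a) z * ((1 - t) * z / (z - x k) * ∏ j ∈ s.erase k, scatter t (x j) (x k)) +
        (1 - t) * z / (z - x a) *
          ((1 - t) * x a / (x a - x k) * ∏ j ∈ s.erase k, scatter t (x j) (x k)) := by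
      intro k hk
      have hka : a ≠ k := fun h => ha (h ▸ hk)
      have h3 : z - x k ≠ 0 := sub_ne_zero.mpr (hs k hk).symm
      have h4 : x a - x k ≠ 0 := sub_ne_zero.mpr (hsa k hk).symm
      rw [Finset.erase_insert_of_ne hka,
        Finset.prod_insert (fun h => ha (Finset.mem_of_mem_erase h))]
      generalize ∏ j ∈ s.erase k, scatter t (x j) (x k) = P
      unfold scatter
      field_simp
      ring
    rw [Finset.sum_congr rfl e, Finset.sum_add_distrib, ← Finset.mul_sum, ← Finset.mul_sum,
      ih z hs, ih (x a) hsa]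
    generalize ∏ j ∈ s, scatter t (x j) z = P
    generalize ∏ j ∈ s, scatter t (x j) (x a) = Q
    unfold scatter
    field_simp
    ring

theorem prodVec_insert {α : K → Module.End K V} (hα : ∀ x y, Commute (α x) (α y)) (x : ι → K)
    (v : V) {s : Finset ι} {a : ι} (ha : a ∉ s) :
    prodVec hα x v (insert a s) = α (x a) (prodVec hα x v s) := by
  rw [prodVec, Finset.noncommProd_insert_of_notMem _ _ _ _ ha]
  rfl

theorem prodVec_toFinset {α : K → Module.End K V} (hα : ∀ x y, Commute (α x) (α y)) (x : ι → K)
    (v : V) {l : List ι} (hl : l.Nodup) :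
    prodVec hα x v l.toFinset = (l.map fun i => α (x i)).prod v := by
  rw [prodVec, Finset.noncommProd_toFinset _ _ _ hl]

variable {t : K} {α δ : K → Module.End K V}

/-- Moving δ(z) through all the α's: either it keeps its argument and meets v as δ(z), or it swaps
arguments and meets v as δ(x_k), leaving α(z) in place of α(x_k). -/
theorem delta_prodVec (h : ExchangeRel t α δ) {x : ι → K} (hx : Function.Injective x) {v : V}
    {d : K → K} (hv : ∀ z, δ z v = d z • v) (s : Finset ι) :
    ∀ z : K, (∀ i ∈ s, x i ≠ z) →
    δ z (prodVec h.comm_α x v s) =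
      (d z * ∏ i ∈ s, scatter t z (x i)) • prodVec h.comm_α x v s -
      ∑ k ∈ s, ((1 - t) * x k / (z - x k) * d (x k) * ∏ i ∈ s.erase k, scatter t (x k) (x i)) •
        α z (prodVec h.comm_α x v (s.erase k)) := by
  induction s using Finset.induction_on with
  | empty => simp [prodVec_empty, hv]
  | insert a s ha ih =>
    intro z hz
    have hs : ∀ i ∈ s, x i ≠ z := fun i hi => hz i (Finset.mem_insert_of_mem hi)
    have hsa : ∀ i ∈ s, x i ≠ x a := fun i hi h => ha (hx h ▸ hi)
    have hza : z - x a ≠ 0 := sub_ne_zero.mpr (hz a (Finset.mem_insert_self _ _)).symm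
    have ex : ∀ w : V, δ z (α (x a) w) = scatter t z (x a) • α (x a) (δ z w) -
        ((1 - t) * x a / (z - x a)) • α z (δ (x a) w) := by
      intro w
      have := congrArg (fun f : Module.End K V => (z - x a)⁻¹ • f w) (h.exch z (x a))
      simp only [LinearMap.smul_apply, LinearMap.sub_apply, Module.End.mul_apply, smul_smul,
        smul_sub, inv_mul_cancel₀ hza, one_smul] at this
      rw [this, scatter, div_eq_inv_mul, div_eq_inv_mul]
    have cm : ∀ w : V, α (x a) (α z w) = α z (α (x a) w) := fun w =>
      LinearMap.congr_fun (h.comm_α (x a) z).eq w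
    -- The eigenvalue term of the hypothesis at x_a gives the new summand k = a; its remaining
    -- summands merge with those of the hypothesis at z.
    rw [prodVec_insert _ _ _ ha, ex, ih z hs, ih (x a) hsa, Finset.sum_insert ha,
      Finset.prod_insert ha, Finset.erase_insert ha]
    have e : ∀ k ∈ s, ((1 - t) * x k / (z - x k) * d (x k) *
          ∏ i ∈ (insert a s).erase k, scatter t (x k) (x i)) •
          α z (prodVec h.comm_α x v ((insert a s).erase k)) =
        scatter t z (x a) • α (x a) (((1 - t) * x k / (z - x k) * d (x k) *
          ∏ i ∈ s.erase k, scatter t (x k) (x i)) • α z (prodVec h.comm_α x v (s.erase k))) -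
        ((1 - t) * x a / (z - x a)) • α z (((1 - t) * x k / (x a - x k) * d (x k) *
          ∏ i ∈ s.erase k, scatter t (x k) (x i)) •
            α (x a) (prodVec h.comm_α x v (s.erase k))) := by
      intro k hk
      have hka : a ≠ k := fun h => ha (h ▸ hk)
      have h3 : z - x k ≠ 0 := sub_ne_zero.mpr (hs k hk).symm
      have h4 : x a - x k ≠ 0 := sub_ne_zero.mpr (hsa k hk).symm
      have h5 : x k - x a ≠ 0 := sub_ne_zero.mpr (hsa k hk)
      have h6 : a ∉ s.erase k := fun h => ha (Finset.mem_of_mem_erase h)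
      rw [Finset.erase_insert_of_ne hka, Finset.prod_insert h6, prodVec_insert _ _ _ h6]
      simp only [map_smul, cm, smul_smul]
      rw [← sub_smul]
      congr 1
      generalize ∏ i ∈ s.erase k, scatter t (x k) (x i) = P
      unfold scatter
      field_simp
      ring
    rw [Finset.sum_congr rfl e, Finset.sum_sub_distrib, ← Finset.smul_sum, ← Finset.smul_sum,
      ← map_sum, ← map_sum]
    simp only [map_sub, map_smul, smul_sub, smul_smul]
    module

/-- Applying one more factor with index a to the term of k, δ(x_a) either keeps k and adds a power
of y, or trades some i ∈ k for a. All contributions to the same subset containing a have the same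
vector, and their coefficients add up by `sum_scatter`. -/
theorem prod_alpha_add_delta (h : ExchangeRel t α δ) {x : ι → K} (hx : Function.Injective x)
    {v : V} {d : K → K} (hv : ∀ z, δ z v = d z • v) {y : Module.End K V}
    (hyα : ∀ z, Commute y (α z)) (hyδ : ∀ z, Commute y (δ z)) (l : List ι) (hl : l.Nodup) :
    (l.map fun j => α (x j) + x j • (y * δ (x j))).prod v =
      ∑ k ∈ l.toFinset.powerset,
        ((∏ j ∈ l.toFinset \ k, x j * d (x j)) *
          ∏ j ∈ l.toFinset \ k, ∏ i ∈ k, scatter t (x j) (x i)) •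
        (y ^ (l.toFinset \ k).card) (prodVec h.comm_α x v k) := by
  induction l with
  | nil => simp [prodVec_empty]
  | cons a l ih =>
    rw [List.nodup_cons] at hl
    have has : a ∉ l.toFinset := by simpa using hl.1
    rw [List.map_cons, List.prod_cons, Module.End.mul_apply, ih hl.2, List.toFinset_cons,
      Finset.sum_powerset_insert has, map_sum]
    generalize l.toFinset = s at has
    have act : ∀ k ∈ s.powerset, ∀ (c : K) (m : ℕ),
        (α (x a) + x a • (y * δ (x a))) (c • (y ^ m) (prodVec h.comm_α x v k)) =
        (c * (x a * d (x a) * ∏ i ∈ k, scatter t (x a) (x i))) •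
          (y ^ (m + 1)) (prodVec h.comm_α x v k) +
        (c • (y ^ m) (prodVec h.comm_α x v (insert a k)) -
        ∑ i ∈ k, (c * ((1 - t) * x a / (x a - x i) * (x i * d (x i)) *
          ∏ j ∈ k.erase i, scatter t (x i) (x j))) •
          (y ^ (m + 1)) (prodVec h.comm_α x v (insert a (k.erase i)))) := by
      intro k hk c m
      have hak : a ∉ k := fun h => has (Finset.mem_powerset.mp hk h)
      have c1 : ∀ w, α (x a) ((y ^ m) w) = (y ^ m) (α (x a) w) := fun w =>
        LinearMap.congr_fun ((hyα (x a)).pow_left m).eq.symm w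
      have c2 : ∀ w, δ (x a) ((y ^ m) w) = (y ^ m) (δ (x a) w) := fun w =>
        LinearMap.congr_fun ((hyδ (x a)).pow_left m).eq.symm w
      have c3 : ∀ w, y ((y ^ m) w) = (y ^ (m + 1)) w := fun w => by
        rw [pow_succ', Module.End.mul_apply]
      simp only [LinearMap.add_apply, LinearMap.smul_apply, Module.End.mul_apply, map_smul]
      rw [c1, c2, c3, delta_prodVec h hx hv k (x a) (fun i hi hia => hak (hx hia ▸ hi)),
        prodVec_insert _ _ _ hak]
      have : ∀ i ∈ k, (c * ((1 - t) * x a / (x a - x i) * (x i * d (x i)) *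
          ∏ j ∈ k.erase i, scatter t (x i) (x j))) •
          (y ^ (m + 1)) (prodVec h.comm_α x v (insert a (k.erase i))) =
          (c * x a) • (y ^ (m + 1)) (((1 - t) * x i / (x a - x i) * d (x i) *
            ∏ j ∈ k.erase i, scatter t (x i) (x j)) •
            α (x a) (prodVec h.comm_α x v (k.erase i))) := by
        intro i hi
        rw [prodVec_insert _ _ _ (fun h => hak (Finset.mem_of_mem_erase h)), map_smul, smul_smul]
        congr 1
        ring
      rw [Finset.sum_congr rfl this, ← Finset.smul_sum, ← map_sum, map_sub, map_smul]
      module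
    rw [Finset.sum_congr rfl fun k hk => act k hk _ _, Finset.sum_add_distrib]
    congr 1
    · refine Finset.sum_congr rfl fun k hk => ?_
      have hak : a ∉ k := fun h => has (Finset.mem_powerset.mp hk h)
      have : a ∉ s \ k := fun h => has (Finset.mem_sdiff.mp h).1
      rw [Finset.insert_sdiff_of_notMem _ hak, Finset.card_insert_of_notMem this,
        Finset.prod_insert this, Finset.prod_insert this]
      congr 1
      ring
    · rw [Finset.sum_sub_distrib]
      -- Reindexing by k with i removed collects the trades that end at the same subset `insert a
      -- k`.
      have swap : ∀ F : Finset ι → ι → V,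
          ∑ k ∈ s.powerset, ∑ i ∈ k, F k i = ∑ k ∈ s.powerset, ∑ i ∈ s \ k, F (insert i k) i := by
        intro F
        rw [Finset.sum_sigma', Finset.sum_sigma']
        refine Finset.sum_bij' (fun p _ => ⟨p.1.erase p.2, p.2⟩) (fun p _ => ⟨insert p.2 p.1, p.2⟩)
          ?_ ?_ ?_ ?_ ?_
        · rintro ⟨k, i⟩ hp
          simp only [Finset.mem_sigma, Finset.mem_powerset, Finset.mem_sdiff] at hp ⊢
          exact ⟨(Finset.erase_subset _ _).trans hp.1, hp.1 hp.2, Finset.notMem_erase _ _⟩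
        · rintro ⟨k, i⟩ hp
          simp only [Finset.mem_sigma, Finset.mem_powerset, Finset.mem_sdiff] at hp ⊢
          exact ⟨Finset.insert_subset hp.2.1 hp.1, Finset.mem_insert_self _ _⟩
        · rintro ⟨k, i⟩ hp
          simp only [Finset.mem_sigma] at hp
          simp [Finset.insert_erase hp.2]
        · rintro ⟨k, i⟩ hp
          simp only [Finset.mem_sigma, Finset.mem_sdiff] at hp
          simp [Finset.erase_insert hp.2.2]
        · rintro ⟨k, i⟩ hp
          simp only [Finset.mem_sigma] at hp
          simp [Finset.insert_erase hp.2]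
      rw [swap, ← Finset.sum_sub_distrib]
      refine Finset.sum_congr rfl fun k hk => ?_
      have hak : a ∉ k := fun h => has (Finset.mem_powerset.mp hk h)
      have hsk : insert a s \ insert a k = s \ k := by
        rw [Finset.insert_sdiff_insert, Finset.sdiff_insert_of_notMem has]
      have term : ∀ i ∈ s \ k,
          (((∏ j ∈ s \ insert i k, x j * d (x j)) *
            ∏ j ∈ s \ insert i k, ∏ i' ∈ insert i k, scatter t (x j) (x i')) *
            ((1 - t) * x a / (x a - x i) * (x i * d (x i)) *
              ∏ j ∈ (insert i k).erase i, scatter t (x i) (x j))) •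
            (y ^ ((s \ insert i k).card + 1))
              (prodVec h.comm_α x v (insert a ((insert i k).erase i))) =
          (((∏ j ∈ s \ k, x j * d (x j)) * ∏ j ∈ s \ k, ∏ i ∈ k, scatter t (x j) (x i)) *
            ((1 - t) * x a / (x a - x i) * ∏ j ∈ (s \ k).erase i, scatter t (x j) (x i))) •
            (y ^ (s \ k).card) (prodVec h.comm_α x v (insert a k)) := by
        intro i hi
        have hik : i ∉ k := (Finset.mem_sdiff.mp hi).2
        have e : s \ insert i k = (s \ k).erase i := by
          rw [Finset.sdiff_insert]
        rw [Finset.erase_insert hik, e, Finset.card_erase_add_one hi,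
          ← Finset.mul_prod_erase _ (fun j => x j * d (x j)) hi,
          ← Finset.mul_prod_erase _ (fun j => ∏ i ∈ k, scatter t (x j) (x i)) hi]
        simp only [Finset.prod_insert hik, Finset.prod_mul_distrib]
        congr 1
        ring
      -- The direct α(x_a) term has relative coefficient 1 and the trades subtract 1 - ∏ (x_j - t
      -- x_a)/(x_j - x_a), leaving the scattering factors of the enlarged subset.
      rw [Finset.sum_congr rfl term, ← Finset.sum_smul, ← sub_smul, hsk, ← Finset.mul_sum,
        sum_scatter t hx (s \ k) (x a)
          (fun i hi hia => has (hx hia ▸ (Finset.mem_sdiff.mp hi).1))]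
      simp only [Finset.prod_insert hak, Finset.prod_mul_distrib]
      congr 1
      ring

end Bethe

/-! ### The operators of one site -/

section Site

variable {K : Type*} [Field K] {M₁ M₂ : ℕ}

theorem create_single (i : Level M₁ M₂) (n : Level M₁ M₂ → ℕ) (c : K) :
    create K i (Finsupp.single n c) = Finsupp.single (Function.update n i (n i + 1)) c := by
  simp [create]

theorem annihilate_single (q : K) (i : Level M₁ M₂) (n : Level M₁ M₂ → ℕ) (c : K) :
    annihilate q i (Finsupp.single n c) =
      Finsupp.single (Function.update n i (n i - 1)) (qNum q (n i) * c) := by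
  simp [annihilate]

theorem create_pow_single (i : Level M₁ M₂) (n : Level M₁ M₂ → ℕ) (c : K) (m : ℕ) :
    (create K i ^ m) (Finsupp.single n c) = Finsupp.single (n + Pi.single i m) c := by
  induction m with
  | zero => simp
  | succ m ih =>
    rw [pow_succ', Module.End.mul_apply, ih, create_single]
    congr 1
    ext j
    by_cases hj : j = i
    · subst hj; simp [add_assoc]
    · simp [hj]

theorem commute_create (i j : Level M₁ M₂) : Commute (create K i) (create K j) := by
  by_cases hij : i = j
  · subst hij; exact Commute.refl _
  refine Finsupp.lhom_ext fun n c => ?_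
  simp only [Module.End.mul_apply, create_single]
  rw [Function.update_of_ne hij, Function.update_of_ne (Ne.symm hij), Function.update_comm hij]

theorem commute_annihilate (q : K) (i j : Level M₁ M₂) :
    Commute (annihilate q i) (annihilate q j) := by
  by_cases hij : i = j
  · subst hij; exact Commute.refl _
  refine Finsupp.lhom_ext fun n c => ?_
  simp only [Module.End.mul_apply, annihilate_single]
  rw [Function.update_of_ne hij, Function.update_of_ne (Ne.symm hij), Function.update_comm hij,
    mul_left_comm]

theorem commute_create_annihilate (q : K) {i j : Level M₁ M₂} (hij : i ≠ j) :
    Commute (create K i) (annihilate q j) := by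
  refine Finsupp.lhom_ext fun n c => ?_
  simp only [Module.End.mul_apply, create_single, annihilate_single]
  rw [Function.update_of_ne hij, Function.update_of_ne (Ne.symm hij), Function.update_comm hij]

theorem annihilate_mul_create (q : K) (i : Level M₁ M₂) :
    ((1 - q) • annihilate q i) * create K i =
      q • (create K i * ((1 - q) • annihilate q i)) + (1 - q) • 1 := by
  have key : annihilate q i * create K i = q • (create K i * annihilate q i) + 1 := by
    refine Finsupp.lhom_ext fun n c => ?_
    simp only [Module.End.mul_apply, create_single, annihilate_single, LinearMap.add_apply,
      LinearMap.smul_apply, Module.End.one_apply, Function.update_self, Function.update_idem,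
      Nat.add_sub_cancel, Function.update_eq_self, Finsupp.smul_single, smul_eq_mul]
    rcases Nat.eq_zero_or_pos (n i) with h | h
    · simp [h, qNum]
    · rw [Nat.sub_add_cancel h, Function.update_eq_self, ← Finsupp.single_add, qNum, qNum,
        Finset.sum_range_succ']
      congr 1
      simp only [pow_succ', ← Finset.mul_sum, pow_zero]
      ring
  rw [smul_mul_assoc, key, mul_smul_comm]
  module

/-- The operators `(α(x), δ(x))` of a chain of energy levels, the highest one first:
the column `L_M(u) ⋯ L_1(u) (1, u)ᵗ` is `(u ^ (-M) α(u ^ 2), u ^ (1 - M) δ(u ^ 2))`. -/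
noncomputable def chain (q x : K) : List (Level M₁ M₂) →
    Module.End K (Fock K M₁ M₂) × Module.End K (Fock K M₁ M₂)
  | [] => (1, 1)
  | i :: l => ((chain q x l).1 + x • (create K i * (chain q x l).2),
      ((1 - q) • annihilate q i) * (chain q x l).1 + x • (chain q x l).2)

theorem commute_chain (q x : K) {T : Module.End K (Fock K M₁ M₂)} {l : List (Level M₁ M₂)}
    (hc : ∀ i ∈ l, Commute T (create K i)) (ha : ∀ i ∈ l, Commute T (annihilate q i)) :
    Commute T (chain q x l).1 ∧ Commute T (chain q x l).2 := by
  induction l with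
  | nil => exact ⟨Commute.one_right _, Commute.one_right _⟩
  | cons i l ih =>
    obtain ⟨h1, h2⟩ := ih (fun j hj => hc j (List.mem_cons_of_mem _ hj))
      (fun j hj => ha j (List.mem_cons_of_mem _ hj))
    have h3 := hc i List.mem_cons_self
    have h4 := ha i List.mem_cons_self
    exact ⟨h1.add_right ((h3.mul_right h2).smul_right x),
      ((h4.smul_right (1 - q)).mul_right h1).add_right (h2.smul_right x)⟩

theorem commute_create_chain (q x : K) {i : Level M₁ M₂} {l : List (Level M₁ M₂)} (hi : i ∉ l) :
    Commute (create K i) (chain q x l).1 ∧ Commute (create K i) (chain q x l).2 :=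
  commute_chain q x (fun _ _ => commute_create _ _)
    fun _ hj => commute_create_annihilate q fun h => hi (h ▸ hj)

theorem commute_annihilate_chain (q x : K) {i : Level M₁ M₂} {l : List (Level M₁ M₂)}
    (hi : i ∉ l) :
    Commute (annihilate q i) (chain q x l).1 ∧ Commute (annihilate q i) (chain q x l).2 :=
  commute_chain q x
    (fun j hj => (commute_create_annihilate q fun h : j = i => hi (h ▸ hj)).symm)
    fun _ _ => commute_annihilate q _ _

theorem exchangeRel_chain (q : K) {l : List (Level M₁ M₂)} (hl : l.Nodup) :
    ExchangeRel q (fun x => (chain q x l).1) (fun x => (chain q x l).2) := by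
  induction l with
  | nil =>
    refine ⟨fun _ _ => Commute.refl _, fun _ _ => Commute.refl _, fun x y => ?_⟩
    simp only [chain]
    module
  | cons i l ih =>
    rw [List.nodup_cons] at hl
    exact (ih hl.2).step (fun x => (commute_create_chain q x hl.1).1)
      (fun x => (commute_create_chain q x hl.1).2)
      (fun x => (commute_annihilate_chain q x hl.1).1.smul_left _)
      (fun x => (commute_annihilate_chain q x hl.1).2.smul_left _) (annihilate_mul_create q i)

/-- On empty levels every term with an annihilator vanishes, since the annihilator of the top level
commutes past the lower levels; only the diagonal entries x remain. -/
theorem chain_snd_single (q x : K) {l : List (Level M₁ M₂)} (hl : l.Nodup)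
    {n : Level M₁ M₂ → ℕ} (hn : ∀ i ∈ l, n i = 0) :
    (chain q x l).2 (Finsupp.single n 1) = x ^ l.length • Finsupp.single n 1 := by
  induction l with
  | nil => simp [chain]
  | cons i l ih =>
    rw [List.nodup_cons] at hl
    have h := LinearMap.congr_fun (commute_annihilate_chain q x hl.1).1.eq (Finsupp.single n 1)
    simp only [Module.End.mul_apply, annihilate_single, hn i List.mem_cons_self] at h
    simp only [chain, LinearMap.add_apply, LinearMap.smul_apply, Module.End.mul_apply, h,
      ih hl.2 fun j hj => hn j (List.mem_cons_of_mem _ hj)]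
    simp only [qNum, Finset.range_zero, Finset.sum_empty, zero_mul, Finsupp.single_zero, map_zero,
      smul_zero, zero_add, smul_smul, List.length_cons, pow_succ']

end Site

/-! ### Expansion over compositions, peeling off the highest level -/

section Compositions

variable {K ι : Type*} [Field K] [Fintype ι] {M₁ M₂ : ℕ}

/-- The occupation numbers of the levels `l`, the highest one first, that belong to `a`. -/
def chainOcc (a : ι → ℕ) : List (Level M₁ M₂) → Level M₁ M₂ → ℕ
  | [] => 0
  | i :: l => chainOcc a l + Pi.single i (Finset.univ.filter fun j => a j = l.length + 1).card

/-- Parts equal to 0 and parts above the highest level are invisible to the occupation numbers. -/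
theorem chainOcc_congr {a b : ι → ℕ} (l : List (Level M₁ M₂))
    (h : ∀ j k, 0 < k → k ≤ l.length → (a j = k ↔ b j = k)) : chainOcc a l = chainOcc b l := by
  induction l with
  | nil => rfl
  | cons i l ih =>
    simp only [chainOcc]
    rw [ih fun j k h1 h2 => h j k h1 (h2.trans (by simp))]
    simp only [h _ (l.length + 1) (Nat.succ_pos _) (by simp)]

theorem chainOcc_ofFn (a : ι → ℕ) {M : ℕ} (level : Fin M → Level M₁ M₂) :
    chainOcc a (List.ofFn level).reverse =
      ∑ k : Fin M, Pi.single (level k) (Finset.univ.filter fun j => a j = (k : ℕ) + 1).card := by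
  induction M with
  | zero => simp [chainOcc]
  | succ M ih =>
    rw [List.ofFn_succ', List.concat_eq_append, List.reverse_append, List.reverse_singleton,
      List.singleton_append, chainOcc, ih, Fin.sum_univ_castSucc]
    simp

variable [DecidableEq ι]

/-- The functions with values in `{0, ..., M}` that vanish outside of `s`. -/
def comps (s : Finset ι) (M : ℕ) : Finset (ι → ℕ) :=
  Fintype.piFinset fun i => if i ∈ s then Finset.range (M + 1) else {0}

theorem mem_comps {s : Finset ι} {M : ℕ} {a : ι → ℕ} :
    a ∈ comps s M ↔ ∀ i, a i ≤ M ∧ (i ∉ s → a i = 0) := by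
  rw [comps, Fintype.mem_piFinset]
  refine forall_congr' fun i => ?_
  by_cases hi : i ∈ s
  · simp [hi]
  · simp only [hi, if_false, Finset.mem_singleton, not_false_eq_true, true_imp_iff]
    omega

/-- The summand of the Hall-Littlewood polynomial in the variables `x_i`, `i ∈ s`, that belongs
to the exponents `a`. -/
def compWeight (t : K) (x : ι → K) (s : Finset ι) (a : ι → ℕ) : K :=
  (∏ i ∈ s, x i ^ a i) * ∏ i ∈ s, ∏ j ∈ s, if a j < a i then scatter t (x i) (x j) else 1

/-- The function with value `m` on `r` and the values of `a` elsewhere. -/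
def raise (r : Finset ι) (m : ℕ) (a : ι → ℕ) (i : ι) : ℕ := if i ∈ r then m else a i

/-- The parts outside k are equal and exceed all those in k, so they scatter exactly off the
variables of k. The prefactor is the one in `prod_alpha_add_delta` with d(x) = x^M. -/
theorem compWeight_raise (t : K) (x : ι → K) {s k : Finset ι} (hk : k ⊆ s) {M : ℕ} {a : ι → ℕ}
    (ha : a ∈ comps k M) :
    compWeight t x s (raise (s \ k) (M + 1) a) =
      ((∏ j ∈ s \ k, x j * x j ^ M) * ∏ j ∈ s \ k, ∏ i ∈ k, scatter t (x j) (x i)) *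
        compWeight t x k a := by
  rw [mem_comps] at ha
  have r1 : ∀ i ∈ s \ k, raise (s \ k) (M + 1) a i = M + 1 := fun i hi => if_pos hi
  have r2 : ∀ i ∈ k, raise (s \ k) (M + 1) a i = a i := fun i hi =>
    if_neg fun h => (Finset.mem_sdiff.mp h).2 hi
  have e1 : ∏ i ∈ s, x i ^ raise (s \ k) (M + 1) a i =
      (∏ j ∈ s \ k, x j * x j ^ M) * ∏ i ∈ k, x i ^ a i := by
    rw [← Finset.prod_sdiff hk]
    congr 1
    · exact Finset.prod_congr rfl fun i hi => by rw [r1 i hi, pow_succ']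
    · exact Finset.prod_congr rfl fun i hi => by rw [r2 i hi]
  have e2 : ∏ i ∈ s, ∏ j ∈ s, (if raise (s \ k) (M + 1) a j < raise (s \ k) (M + 1) a i then
        scatter t (x i) (x j) else 1) =
      (∏ j ∈ s \ k, ∏ i ∈ k, scatter t (x j) (x i)) *
        ∏ i ∈ k, ∏ j ∈ k, if a j < a i then scatter t (x i) (x j) else 1 := by
    rw [← Finset.prod_sdiff hk]
    congr 1
    · refine Finset.prod_congr rfl fun i hi => ?_
      rw [← Finset.prod_sdiff hk, Finset.prod_eq_one, one_mul]
      · refine Finset.prod_congr rfl fun j hj => ?_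
        rw [r1 i hi, r2 j hj, if_pos (Nat.lt_succ_of_le (ha j).1)]
      · intro j hj
        rw [r1 i hi, r1 j hj, if_neg (lt_irrefl _)]
    · refine Finset.prod_congr rfl fun i hi => ?_
      rw [← Finset.prod_sdiff hk, Finset.prod_eq_one, one_mul]
      · refine Finset.prod_congr rfl fun j hj => ?_
        rw [r2 i hi, r2 j hj]
      · intro j hj
        rw [r2 i hi, r1 j hj, if_neg]
        have := (ha i).1
        omega
  rw [compWeight, compWeight, e1, e2]
  ring

theorem chainOcc_raise {s k : Finset ι} {a : ι → ℕ} (i : Level M₁ M₂)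
    {l : List (Level M₁ M₂)} (ha : a ∈ comps k l.length) :
    chainOcc (raise (s \ k) (l.length + 1) a) (i :: l) =
      chainOcc a l + Pi.single i (s \ k).card := by
  rw [mem_comps] at ha
  simp only [chainOcc]
  congr 1
  · refine chainOcc_congr l fun j m h1 h2 => ?_
    unfold raise
    split_ifs with h
    · have := (ha j).2 (Finset.mem_sdiff.mp h).2
      omega
    · rfl
  · congr 2
    ext j
    rw [Finset.mem_filter_univ, raise]
    split_ifs with h
    · simp [h]
    · have := (ha j).1
      simp only [h, iff_false]
      omega

/-- A composition with parts at most M + 1 is determined by the set k of indices in s whose part is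
at most M, and by its restriction to k. -/
theorem sum_comps_succ {V : Type*} [AddCommMonoid V] (s : Finset ι) (M : ℕ) (F : (ι → ℕ) → V) :
    ∑ a ∈ comps s (M + 1), F a =
      ∑ k ∈ s.powerset, ∑ a ∈ comps k M, F (raise (s \ k) (M + 1) a) := by
  symm
  rw [Finset.sum_sigma']
  refine Finset.sum_bij' (fun p _ => raise (s \ p.1) (M + 1) p.2)
    (fun a _ => ⟨s.filter fun i => a i ≤ M, fun i => if a i ≤ M then a i else 0⟩) ?_ ?_ ?_ ?_ ?_
  · rintro ⟨k, a⟩ hp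
    simp only [Finset.mem_sigma, Finset.mem_powerset, mem_comps] at hp ⊢
    intro i
    have h1 := hp.2 i
    have h2 := @hp.1 i
    unfold raise
    simp only [Finset.mem_sdiff]
    split_ifs with h
    · exact ⟨le_rfl, fun h' => absurd h.1 h'⟩
    · exact ⟨by omega, fun h' => h1.2 fun h'' => h' (h2 h'')⟩
  · intro a ha
    simp only [Finset.mem_sigma, Finset.mem_powerset, mem_comps] at ha ⊢
    refine ⟨Finset.filter_subset _ _, fun i => ?_⟩
    have := ha i
    simp only [Finset.mem_filter, not_and]
    split_ifs with h
    · exact ⟨h, fun h' => this.2 fun h'' => h' h'' h⟩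
    · simp
  · rintro ⟨k, a⟩ hp
    simp only [Finset.mem_sigma, Finset.mem_powerset, mem_comps] at hp
    obtain ⟨hk, ha⟩ := hp
    have e1 : (s.filter fun i => raise (s \ k) (M + 1) a i ≤ M) = k := by
      ext i
      have := (ha i).1
      simp only [Finset.mem_filter, raise, Finset.mem_sdiff]
      by_cases hi : i ∈ k
      · simp [hi, hk hi, this]
      · by_cases hs : i ∈ s <;> simp [hi, hs]
    have e2 : (fun i => if raise (s \ k) (M + 1) a i ≤ M then raise (s \ k) (M + 1) a i else 0) =
        a := by
      ext i
      have := ha i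
      simp only [raise, Finset.mem_sdiff]
      by_cases hi : i ∈ k
      · simp [hi, this.1]
      · by_cases hs : i ∈ s <;> simp [hi, hs, this.2 hi]
    simp only [e1, e2]
  · intro a ha
    simp only [mem_comps] at ha
    ext i
    have := ha i
    simp only [raise, Finset.mem_sdiff, Finset.mem_filter, not_and]
    by_cases hs : i ∈ s
    · by_cases h : a i ≤ M
      · simp [h]
      · simp only [hs, h, not_false_eq_true, imp_self, and_self, if_true]
        omega
    · simp [hs, this.2 hs]
  · intros; rfl

/-- Induction on the levels: `prod_alpha_add_delta`, with y the creation operator of the top level,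
matches the recursion of the compositions term by term. -/
theorem prodVec_chain (t : K) {x : ι → K} (hx : Function.Injective x) {l : List (Level M₁ M₂)}
    (hl : l.Nodup) {n : Level M₁ M₂ → ℕ} (hn : ∀ i ∈ l, n i = 0) (s : Finset ι) :
    prodVec (exchangeRel_chain t hl).comm_α x (Finsupp.single n 1) s =
      ∑ a ∈ comps s l.length, compWeight t x s a • Finsupp.single (n + chainOcc a l) 1 := by
  induction l generalizing s with
  | nil =>
    have : comps s 0 = {0} := by
      ext a
      rw [mem_comps, Finset.mem_singleton, funext_iff]
      exact forall_congr' fun i => by simp +contextual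
    have e := prodVec_toFinset (exchangeRel_chain (M₁ := M₁) (M₂ := M₂) t List.nodup_nil).comm_α x
      (Finsupp.single n 1) s.nodup_toList
    rw [Finset.toList_toFinset] at e
    rw [e, List.length_nil, this]
    have hw : compWeight t x s (0 : ι → ℕ) = 1 := by simp [compWeight]
    rw [Finset.sum_singleton, hw, one_smul]
    simp [chain, chainOcc]
  | cons i l ih =>
    have hl' := List.nodup_cons.mp hl
    have e := prodVec_toFinset (exchangeRel_chain t hl).comm_α x
      (Finsupp.single n 1) s.nodup_toList
    have hnl : ∀ j ∈ l, n j = 0 := fun j hj => hn j (List.mem_cons_of_mem _ hj)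
    have e' := prod_alpha_add_delta (exchangeRel_chain t hl'.2) hx
      (fun z => chain_snd_single t z hl'.2 hnl)
      (fun z => (commute_create_chain t z hl'.1).1) (fun z => (commute_create_chain t z hl'.1).2)
      s.toList s.nodup_toList
    rw [Finset.toList_toFinset] at e e'
    rw [e, List.length_cons, sum_comps_succ]
    refine e'.trans (Finset.sum_congr rfl fun k hk => ?_)
    rw [ih hl'.2 hnl k, map_sum, Finset.smul_sum]
    refine Finset.sum_congr rfl fun a ha => ?_
    rw [map_smul, create_pow_single, smul_smul, compWeight_raise t x (Finset.mem_powerset.mp hk) ha,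
      chainOcc_raise i ha, add_assoc]

end Compositions

/-! ### From compositions to Young diagrams -/

section Diagrams

/-- The values of `a` are, up to order, the row lengths of a Young diagram. -/
theorem exists_youngDiagram {n : ℕ} (a : Fin n → ℕ) :
    ∃ (lam : YoungDiagram) (w : Equiv.Perm (Fin n)), lam.colLen 0 ≤ n ∧
      ∀ i, lam.rowLen (w i) = a i := by
  set σ : Equiv.Perm (Fin n) := Fin.revPerm.trans (Tuple.sort a)
  have hanti : Antitone (a ∘ σ) := fun i j hij =>
    Tuple.monotone_sort a (Fin.rev_le_rev.mpr hij)
  let r : ℕ → ℕ := fun i => if h : i < n then a (σ ⟨i, h⟩) else 0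
  have hr : Antitone r := by
    intro i j hij
    simp only [r]
    split_ifs with h1 h2 h2
    · exact hanti (show (⟨i, h2⟩ : Fin n) ≤ ⟨j, h1⟩ from hij)
    · omega
    · exact Nat.zero_le _
    · exact le_rfl
  let lam : YoungDiagram :=
    { cells := (Finset.range n).biUnion fun i => (Finset.range (r i)).image fun j => (i, j)
      isLowerSet := by
        rintro ⟨i, j⟩ ⟨i', j'⟩ h hm
        obtain ⟨h1, h2⟩ : i' ≤ i ∧ j' ≤ j := h
        simp only [Finset.coe_biUnion, Finset.coe_range, Set.mem_Iio, Finset.coe_image,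
          Set.mem_iUnion, Set.mem_image, Prod.mk.injEq, exists_prop] at hm ⊢
        obtain ⟨i0, h3, j0, h4, rfl, rfl⟩ := hm
        have := hr h1
        exact ⟨i', by omega, j', by omega, rfl, rfl⟩ }
  have hmem : ∀ i j, (i, j) ∈ lam ↔ i < n ∧ j < r i := by
    intro i j
    rw [← YoungDiagram.mem_cells]
    simp [lam]
  have hrow : ∀ i, lam.rowLen i = r i := by
    intro i
    refine eq_of_forall_lt_iff fun j => ?_
    rw [← YoungDiagram.mem_iff_lt_rowLen, hmem]
    simp only [r]
    split_ifs with h <;> simp [h]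
  refine ⟨lam, σ.symm, ?_, fun i => ?_⟩
  · by_contra! h
    exact absurd ((hmem _ _).mp (YoungDiagram.mem_iff_lt_colLen.mpr h)).1 (lt_irrefl _)
  · rw [hrow]
    simp [r]

theorem rowLen_eq_zero {lam : YoungDiagram} {n i : ℕ} (h : lam.colLen 0 ≤ n) (hi : n ≤ i) :
    lam.rowLen i = 0 := by
  by_contra h0
  have h1 := YoungDiagram.mem_iff_lt_rowLen.mpr (Nat.pos_of_ne_zero h0)
  have h2 := YoungDiagram.mem_iff_lt_colLen.mp h1
  omega

theorem colLen_eq_card {lam : YoungDiagram} {n : ℕ} (h : lam.colLen 0 ≤ n) (j : ℕ) :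
    lam.colLen j = (Finset.univ.filter fun i : Fin n => j < lam.rowLen i).card := by
  have h1 : lam.colLen j ≤ n := (lam.colLen_anti 0 j (Nat.zero_le _)).trans h
  have : (Finset.univ.filter fun i : Fin n => j < lam.rowLen i) =
      Finset.univ.filter fun i : Fin n => (i : ℕ) < lam.colLen j := by
    ext i
    simp [← YoungDiagram.mem_iff_lt_rowLen, ← YoungDiagram.mem_iff_lt_colLen]
  rw [this, Fin.card_filter_val_lt, min_eq_right h1]

/-- Column lengths count the rows longer than a given value, so they do not see the permutation. -/
theorem youngDiagram_ext {n : ℕ} {lam mu : YoungDiagram} (hl : lam.colLen 0 ≤ n)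
    (hm : mu.colLen 0 ≤ n) (w : Equiv.Perm (Fin n))
    (h : ∀ i, lam.rowLen (w i) = mu.rowLen i) : lam = mu := by
  have hc : ∀ j, lam.colLen j = mu.colLen j := by
    intro j
    rw [colLen_eq_card hl, colLen_eq_card hm]
    refine (Finset.card_equiv w fun i => ?_).symm
    simp [h]
  ext ⟨i, j⟩
  rw [YoungDiagram.mem_cells, YoungDiagram.mem_cells, YoungDiagram.mem_iff_lt_colLen,
    YoungDiagram.mem_iff_lt_colLen, hc]

theorem mem_box {n M : ℕ} {lam : YoungDiagram} :
    lam ∈ box n M ↔ lam.colLen 0 ≤ n ∧ lam.rowLen 0 ≤ M := by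
  simp [box]

theorem count_rowLens {n : ℕ} {lam : YoungDiagram} (h : lam.colLen 0 ≤ n) {k : ℕ} (hk : 0 < k) :
    lam.rowLens.count k = (Finset.univ.filter fun i : Fin n => lam.rowLen i = k).card := by
  have e : lam.rowLens.count k = ((Finset.range (lam.colLen 0)).filter
      fun i => lam.rowLen i = k).card := by
    rw [← Nat.count_eq_card_filter_range, YoungDiagram.rowLens, List.count, List.countP_map]
    rfl
  rw [e]
  symm
  refine Finset.card_bij (fun i _ => (i : ℕ)) (fun i hi => ?_) (fun i _ j _ h => Fin.ext h)
    fun i hi => ?_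
  · rw [Finset.mem_filter_univ] at hi
    rw [Finset.mem_filter, Finset.mem_range, ← YoungDiagram.mem_iff_lt_colLen,
      YoungDiagram.mem_iff_lt_rowLen]
    exact ⟨by omega, hi⟩
  · rw [Finset.mem_filter, Finset.mem_range] at hi
    exact ⟨⟨i, by omega⟩, by simpa using hi.2, rfl⟩

/-- The Hall-Littlewood polynomials collect the weights of the compositions. -/
theorem sum_compWeight {K V : Type*} [Field K] [AddCommGroup V] [Module K V] (t : K) {n : ℕ}
    (x : Fin n → K) (M : ℕ) (G : (ℕ → ℕ) → V) :
    ∑ a ∈ comps Finset.univ M, compWeight t x Finset.univ a •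
        G (fun k => (Finset.univ.filter fun j => a j = k + 1).card) =
      ∑ lam ∈ box n M, hallLittlewoodP t x lam • G fun k => lam.rowLens.count (k + 1) := by
  classical
  choose Y w hY hw using fun a : Fin n → ℕ => exists_youngDiagram a
  have hmaps : ∀ a ∈ comps (Finset.univ : Finset (Fin n)) M, Y a ∈ box n M := by
    intro a ha
    rw [mem_comps] at ha
    refine mem_box.mpr ⟨hY a, ?_⟩
    rcases Nat.eq_zero_or_pos n with h0 | h0
    · rw [rowLen_eq_zero (hY a) h0.le]
      exact Nat.zero_le _
    · have := hw a ((w a).symm ⟨0, h0⟩)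
      rw [Equiv.apply_symm_apply] at this
      rw [this]
      exact (ha _).1
  rw [← Finset.sum_fiberwise_of_maps_to hmaps]
  refine Finset.sum_congr rfl fun lam hlam => ?_
  rw [mem_box] at hlam
  -- The fibre of sorting over a diagram is the set of its distinct rearrangements, the index set of
  -- the Hall-Littlewood sum.
  have hset : (comps (Finset.univ : Finset (Fin n)) M).filter (fun a => Y a = lam) =
      Finset.univ.image fun (v : Equiv.Perm (Fin n)) (i : Fin n) => lam.rowLen (v i) := by
    ext a
    simp only [Finset.mem_filter, Finset.mem_image, Finset.mem_univ, true_and]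
    constructor
    · rintro ⟨_, rfl⟩
      exact ⟨w a, funext (hw a)⟩
    · rintro ⟨v, rfl⟩
      refine ⟨mem_comps.mpr fun i => ⟨(lam.rowLen_anti 0 _ (Nat.zero_le _)).trans hlam.2,
        fun h => absurd (Finset.mem_univ i) h⟩, ?_⟩
      refine youngDiagram_ext (hY _) hlam.1 (v.symm.trans (w fun i => lam.rowLen (v i))) fun i => ?_
      rw [Equiv.trans_apply, hw, Equiv.apply_symm_apply]
  rw [hallLittlewoodP, if_pos hlam.1, ← hset, Finset.sum_smul]
  refine Finset.sum_congr rfl fun a ha => ?_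
  rw [hset, Finset.mem_image] at ha
  obtain ⟨v, -, rfl⟩ := ha
  congr 2
  funext k
  rw [count_rowLens hlam.1 k.succ_pos]
  refine Finset.card_equiv v fun i => ?_
  simp

end Diagrams

/-! ### Factorization of B(u) over the two sites -/

section Monodromy

variable {K : Type*} [Field K] {M₁ M₂ : ℕ}

/-- The columns of a one-site monodromy matrix in terms of `chain`. -/
theorem lMatrix_prod (q : K) {u : K} (hu : u ≠ 0) (l : List (Level M₁ M₂)) :
    (l.map fun i => lMatrix u (create K i) ((1 - q) • annihilate q i)).prod * lMatrix u 1 1 =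
      !![u⁻¹ ^ (l.length + 1) • (chain q (u ^ 2) l).1, u⁻¹ ^ l.length • (chain q (u ^ 2) l).1;
        u⁻¹ ^ l.length • (chain q (u ^ 2) l).2, (u⁻¹ ^ l.length * u) • (chain q (u ^ 2) l).2] := by
  induction l with
  | nil => simp [lMatrix, chain]
  | cons i l ih =>
    rw [List.map_cons, List.prod_cons, mul_assoc, ih, lMatrix]
    ext a b : 1
    fin_cases a <;> fin_cases b <;>
      simp only [Matrix.mul_apply, Fin.sum_univ_two, Matrix.of_apply, Matrix.cons_val',
        Matrix.cons_val_zero, Matrix.cons_val_one, Matrix.cons_val_fin_one, Fin.zero_eta,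
        Fin.mk_one, Fin.isValue, chain, List.length_cons, smul_add, smul_smul, smul_mul_assoc,
        mul_smul_comm, one_mul, inv_pow] <;>
      match_scalars <;> field_simp <;> ring

theorem siteMonodromy_eq (q : K) {u : K} (hu : u ≠ 0) {M : ℕ} (level : Fin M → Level M₁ M₂) :
    siteMonodromy q level u =
      !![u⁻¹ ^ (M + 1) • (chain q (u ^ 2) (List.ofFn level).reverse).1,
        u⁻¹ ^ M • (chain q (u ^ 2) (List.ofFn level).reverse).1;
        u⁻¹ ^ M • (chain q (u ^ 2) (List.ofFn level).reverse).2,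
        (u⁻¹ ^ M * u) • (chain q (u ^ 2) (List.ofFn level).reverse).2] := by
  have := lMatrix_prod q hu (List.ofFn level).reverse
  rw [List.map_reverse, List.map_ofFn, List.length_reverse, List.length_ofFn] at this
  exact this

/-- The levels of the first site, the highest one first. -/
def levels₁ (M₁ M₂ : ℕ) : List (Level M₁ M₂) := (List.ofFn Sum.inl).reverse

/-- The levels of the second site, the highest one first. -/
def levels₂ (M₁ M₂ : ℕ) : List (Level M₁ M₂) := (List.ofFn Sum.inr).reverse

theorem nodup_levels₁ : (levels₁ M₁ M₂).Nodup :=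
  List.nodup_reverse.mpr (List.nodup_ofFn.mpr Sum.inl_injective)

theorem nodup_levels₂ : (levels₂ M₁ M₂).Nodup :=
  List.nodup_reverse.mpr (List.nodup_ofFn.mpr Sum.inr_injective)

theorem opB_eq (q : K) {u : K} (hu : u ≠ 0) :
    opB q M₁ M₂ u = u⁻¹ ^ (M₁ + M₂ + 1) • ((chain q (u ^ 2) (levels₂ M₁ M₂)).1 *
      ((chain q (u ^ 2) (levels₁ M₁ M₂)).1 +
        u ^ 2 • (1 * (chain q (u ^ 2) (levels₁ M₁ M₂)).2))) := by
  have h : u⁻¹ ^ (M₁ + M₂ + 1) * u ^ 2 = u⁻¹ ^ M₂ * (u⁻¹ ^ M₁ * u) := by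
    simp only [inv_pow]
    field_simp
    ring
  rw [opB, monodromy, siteMonodromy_eq q hu, siteMonodromy_eq q hu, Matrix.mul_apply,
    Fin.sum_univ_two]
  simp only [Matrix.of_apply, Matrix.cons_val', Matrix.cons_val_zero, Matrix.cons_val_one,
    Matrix.cons_val_fin_one, smul_mul_assoc, mul_smul_comm, smul_smul, one_mul, mul_add, smul_add,
    h, levels₁, levels₂]
  congr 2 <;> ring

theorem commute_chain_levels (q x y : K) :
    Commute (chain q x (levels₂ M₁ M₂)).1
      ((chain q y (levels₁ M₁ M₂)).1 + y • (1 * (chain q y (levels₁ M₁ M₂)).2)) := by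
  have hne : ∀ i ∈ levels₁ M₁ M₂, i ∉ levels₂ M₁ M₂ := by
    intro i hi hj
    simp only [levels₁, levels₂, List.mem_reverse, List.mem_ofFn] at hi hj
    obtain ⟨a, rfl⟩ := hi
    obtain ⟨b, hb⟩ := hj
    exact Sum.inr_ne_inl hb
  have h := commute_chain q y (T := (chain q x (levels₂ M₁ M₂)).1) (l := levels₁ M₁ M₂)
    (fun i hi => (commute_create_chain q x (hne i hi)).1.symm)
    (fun i hi => (commute_annihilate_chain q x (hne i hi)).1.symm)
  rw [one_mul]
  exact h.1.add_right (h.2.smul_right y)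

theorem prod_map_smul_mul {A ι : Type*} [Ring A] [Algebra K A] (c : ι → K) {f g : ι → A}
    (hfg : ∀ i j, Commute (f i) (g j)) (l : List ι) :
    (l.map fun i => c i • (f i * g i)).prod =
      (l.map c).prod • ((l.map f).prod * (l.map g).prod) := by
  induction l with
  | nil => simp
  | cons i l ih =>
    have : Commute (g i) (l.map f).prod := Commute.list_prod_right _ _ fun a ha => by
      obtain ⟨j, -, rfl⟩ := List.mem_map.mp ha
      exact (hfg j i).symm
    simp only [List.map_cons, List.prod_cons, ih, smul_mul_assoc, mul_smul_comm, smul_smul]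
    rw [mul_assoc (f i), ← mul_assoc (g i), this.eq]
    simp only [mul_assoc, mul_comm (c i)]

end Monodromy

/-! ### Assembling the Bethe vector -/

section Expansion

variable {K : Type*} [Field K] {M₁ M₂ : ℕ}

theorem prodVec_chain_univ (t : K) {n : ℕ} {x : Fin n → K} (hx : Function.Injective x) {M : ℕ}
    (level : Fin M → Level M₁ M₂) (hl : (List.ofFn level).reverse.Nodup)
    {e : Level M₁ M₂ → ℕ} (he : ∀ k, e (level k) = 0) :
    prodVec (exchangeRel_chain t hl).comm_α x (Finsupp.single e 1) Finset.univ =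
      ∑ lam ∈ box n M, hallLittlewoodP t x lam • Finsupp.single
        (e + ∑ k : Fin M, Pi.single (level k) (lam.rowLens.count ((k : ℕ) + 1))) 1 := by
  have hn : ∀ i ∈ (List.ofFn level).reverse, e i = 0 := by
    intro i hi
    obtain ⟨k, rfl⟩ := List.mem_ofFn.mp (List.mem_reverse.mp hi)
    exact he k
  refine (prodVec_chain t hx hl hn Finset.univ).trans ?_
  rw [List.length_reverse, List.length_ofFn]
  simp only [chainOcc_ofFn]
  have key := sum_compWeight (V := Fock K M₁ M₂) t x M
    fun c => Finsupp.single (e + ∑ k : Fin M, Pi.single (level k) (c k)) 1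
  beta_reduce at key
  exact key

theorem prodVec_comp_orderEmbOfFin {V ι : Type*} [AddCommGroup V] [Module K V] [LinearOrder ι]
    {α : K → Module.End K V} (hα : ∀ x y, Commute (α x) (α y)) (x : ι → K) (v : V)
    (k : Finset ι) :
    prodVec hα x v k = prodVec hα (fun s => x (k.orderEmbOfFin rfl s)) v Finset.univ := by
  have e1 : k = (List.ofFn (k.orderEmbOfFin rfl)).toFinset := by
    ext i
    rw [List.mem_toFinset, List.mem_ofFn, ← Set.mem_range, Finset.range_orderEmbOfFin,
      Finset.mem_coe]
  have h1 := prodVec_toFinset hα x v (List.nodup_ofFn.mpr (k.orderEmbOfFin rfl).injective)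
  have h2 := prodVec_toFinset hα (fun s => x (k.orderEmbOfFin rfl s)) v (List.nodup_finRange k.card)
  rw [← e1, List.map_ofFn] at h1
  rw [List.toFinset_finRange, ← List.ofFn_eq_map] at h2
  rw [h1, h2]
  rfl

theorem occupation_eq (lam mu : YoungDiagram) :
    (∑ k : Fin M₁, Pi.single (Sum.inl k : Level M₁ M₂) (lam.rowLens.count ((k : ℕ) + 1))) +
      (∑ k : Fin M₂, Pi.single (Sum.inr k : Level M₁ M₂) (mu.rowLens.count ((k : ℕ) + 1))) =
      occupation M₁ M₂ lam mu := by
  funext i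
  rcases i with i | i <;>
    simp [occupation, Finset.sum_apply, Pi.single_apply]

theorem betheVector_eq (t : K) (M₁ M₂ : ℕ) {N : ℕ} (u : Fin N → K) (hu_ne : ∀ j, u j ≠ 0)
    (hu_sq : ∀ i j, i ≠ j → u i ^ 2 ≠ u j ^ 2) :
    betheVector t M₁ M₂ u =
      ∑ k : Finset (Fin N), ∑ lam ∈ box k.card M₁, ∑ mu ∈ box N M₂,
        coefficient t M₁ M₂ u k lam mu • ket K M₁ M₂ lam mu := by
  set x : Fin N → K := fun j => u j ^ 2
  have hx : Function.Injective x := fun i j h => by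
    by_contra hij
    exact hu_sq i j hij h
  have hB : (List.ofFn fun j => opB t M₁ M₂ (u j)).prod =
      (∏ j, (u j)⁻¹ ^ (M₁ + M₂ + 1)) •
        (((List.finRange N).map fun j => (chain t (x j) (levels₂ M₁ M₂)).1).prod *
          ((List.finRange N).map fun j => (chain t (x j) (levels₁ M₁ M₂)).1 +
            x j • (1 * (chain t (x j) (levels₁ M₁ M₂)).2)).prod) := by
    have h := prod_map_smul_mul (fun j => (u j)⁻¹ ^ (M₁ + M₂ + 1))
      (f := fun j => (chain t (x j) (levels₂ M₁ M₂)).1)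
      (g := fun j => (chain t (x j) (levels₁ M₁ M₂)).1 +
        x j • (1 * (chain t (x j) (levels₁ M₁ M₂)).2))
      (fun i j => commute_chain_levels t (x i) (x j)) (List.finRange N)
    rw [List.ofFn_eq_map, ← List.prod_ofFn, List.ofFn_eq_map, ← h]
    congr 2
    funext j
    exact opB_eq t (hu_ne j)
  -- Here y = 1, so the indices outside k create no particle and leave only scalars.
  have h₁ := prod_alpha_add_delta (exchangeRel_chain t (nodup_levels₁ (M₁ := M₁) (M₂ := M₂))) hx
    (fun z => chain_snd_single t z nodup_levels₁ (n := 0) fun _ _ => rfl)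
    (fun _ => Commute.one_left _) (fun _ => Commute.one_left _) _ (List.nodup_finRange N)
  have h₂ : ∀ e : Level M₁ M₂ → ℕ, (∀ k, e (Sum.inr k) = 0) →
      ((List.finRange N).map fun j => (chain t (x j) (levels₂ M₁ M₂)).1).prod
        (Finsupp.single e 1) = ∑ mu ∈ box N M₂, hallLittlewoodP t x mu • Finsupp.single
        (e + ∑ k : Fin M₂, Pi.single (Sum.inr k) (mu.rowLens.count ((k : ℕ) + 1))) 1 := by
    intro e he
    rw [← prodVec_chain_univ t hx _ nodup_levels₂ he]
    have := prodVec_toFinset (exchangeRel_chain t (nodup_levels₂ (M₁ := M₁) (M₂ := M₂))).comm_α x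
      (Finsupp.single e 1) (List.nodup_finRange N)
    rw [List.toFinset_finRange] at this
    exact this.symm
  rw [betheVector, vacuum, hB, LinearMap.smul_apply, Module.End.mul_apply, h₁,
    List.toFinset_finRange, Finset.powerset_univ, map_sum, Finset.smul_sum]
  refine Finset.sum_congr rfl fun k _ => ?_
  have hk := prodVec_chain_univ t (x := fun s => x (k.orderEmbOfFin rfl s))
    (hx.comp (k.orderEmbOfFin rfl).injective) Sum.inl (nodup_levels₁ (M₁ := M₁) (M₂ := M₂))
    (e := 0) fun _ => rfl
  rw [one_pow, Module.End.one_apply, prodVec_comp_orderEmbOfFin]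
  erw [hk]
  rw [map_smul, map_sum, Finset.smul_sum, Finset.smul_sum]
  refine Finset.sum_congr rfl fun lam _ => ?_
  rw [map_smul, h₂ _ (by simp [Finset.sum_apply]), Finset.smul_sum,
    Finset.smul_sum, Finset.smul_sum]
  refine Finset.sum_congr rfl fun mu _ => ?_
  rw [zero_add, occupation_eq, ket, smul_smul, smul_smul, smul_smul]
  congr 1
  have hlen : (levels₁ M₁ M₂).length = M₁ := by simp [levels₁]
  have hu0 : ∀ s : Finset (Fin N), ∏ j ∈ s, u j ≠ 0 := fun s =>
    Finset.prod_ne_zero_iff.mpr fun j _ => hu_ne j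
  have e1 : ∏ l ∈ k, ∏ j ∈ kᶜ, (u j ^ 2 - t * u l ^ 2) / (u j ^ 2 - u l ^ 2) =
      ∏ j ∈ kᶜ, ∏ i ∈ k, scatter t (x j) (x i) := Finset.prod_comm
  -- Each j outside k carries u_j^(2M₁+2): one x_j stands in front of δ, and x_j^M₁ is its vacuum
  -- eigenvalue. Completing this product to all j produces the negative power over k.
  have e2 : (∏ j, (u j)⁻¹ ^ (M₁ + M₂ + 1)) * ∏ j ∈ kᶜ, x j * x j ^ M₁ =
      (∏ j, u j) ^ (-(M₂ : ℤ) + M₁ + 1) * (∏ l ∈ k, u l) ^ (-2 * (M₁ : ℤ) - 2) := by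
    have e3 : ∏ j ∈ kᶜ, x j * x j ^ M₁ = (∏ j ∈ kᶜ, u j) ^ (2 * (M₁ : ℤ) + 2) := by
      rw [← Finset.prod_zpow]
      refine Finset.prod_congr rfl fun j _ => ?_
      rw [← pow_succ', ← pow_mul, ← zpow_natCast]
      congr 1
    have e4 : ∏ j, (u j)⁻¹ ^ (M₁ + M₂ + 1) = (∏ j, u j) ^ (-(M₁ : ℤ) - M₂ - 1) := by
      rw [← Finset.prod_zpow]
      refine Finset.prod_congr rfl fun j _ => ?_
      rw [inv_pow, ← zpow_natCast, ← zpow_neg]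
      congr 1
      omega
    rw [e3, e4, ← Finset.prod_mul_prod_compl k u, mul_zpow, mul_zpow, mul_assoc,
      ← zpow_add₀ (hu0 _), mul_right_comm, ← zpow_add₀ (hu0 _)]
    congr 2 <;> ring
  rw [coefficient, ← e2, e1, hlen, ← Finset.compl_eq_univ_sdiff]
  simp only [x]
  ring

end Expansion

/-! ### The image under ȷ -/

section Image

theorem rowsOfOccupation_succ {M : ℕ} (n : Fin (M + 1) → ℕ) :
    rowsOfOccupation n =
      List.replicate (n (Fin.last M)) (M + 1) ++ rowsOfOccupation fun i => n i.castSucc := by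
  rw [rowsOfOccupation, List.ofFn_succ', List.concat_eq_append, List.reverse_append]
  rfl

theorem count_rowsOfOccupation {M : ℕ} (n : Fin M → ℕ) (k : ℕ) :
    (rowsOfOccupation n).count k = ∑ i : Fin M, if (i : ℕ) + 1 = k then n i else 0 := by
  induction M with
  | zero => simp [rowsOfOccupation]
  | succ M ih =>
    rw [rowsOfOccupation_succ, List.count_append, ih, Fin.sum_univ_castSucc, add_comm,
      List.count_replicate]
    simp

theorem le_of_mem_rowsOfOccupation {M : ℕ} {n : Fin M → ℕ} {k : ℕ}
    (hk : k ∈ rowsOfOccupation n) : k ≤ M := by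
  rw [← List.count_pos_iff, count_rowsOfOccupation] at hk
  obtain ⟨i, -, hi⟩ := Finset.exists_ne_zero_of_sum_ne_zero hk.ne'
  have : (i : ℕ) + 1 = k := by
    by_contra h
    exact hi (if_neg h)
  omega

theorem rowsOfOccupation_sorted {M : ℕ} (n : Fin M → ℕ) : (rowsOfOccupation n).SortedGE := by
  rw [List.sortedGE_iff_pairwise]
  induction M with
  | zero => simp [rowsOfOccupation]
  | succ M ih =>
    rw [rowsOfOccupation_succ, List.pairwise_append]
    refine ⟨List.pairwise_replicate_of_refl, ih _, fun a ha b hb => ?_⟩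
    have := le_of_mem_rowsOfOccupation hb
    have := List.eq_of_mem_replicate ha
    omega

/-- Both lists are weakly decreasing with the same multiplicities; the bound on the columns ensures
that no row exceeds the highest level. -/
theorem rowsOfOccupation_count {M : ℕ} {lam : YoungDiagram} (h : lam.rowLen 0 ≤ M) :
    rowsOfOccupation (fun i : Fin M => lam.rowLens.count ((i : ℕ) + 1)) = lam.rowLens := by
  refine List.Perm.eq_of_sortedGE (rowsOfOccupation_sorted _) lam.rowLens_sorted
    (List.perm_iff_count.mpr fun k => ?_)
  rw [count_rowsOfOccupation]
  by_cases hk : 0 < k ∧ k ≤ M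
  · rw [Finset.sum_eq_single ⟨k - 1, by omega⟩]
    · simp [Nat.sub_add_cancel hk.1]
    · intro i _ hi
      refine if_neg fun h => hi (Fin.ext ?_)
      simp only
      omega
    · simp
  · rw [Finset.sum_eq_zero fun i _ => if_neg (by omega), eq_comm, List.count_eq_zero]
    intro hm
    have h0 := lam.pos_of_mem_rowLens k hm
    obtain ⟨i, -, rfl⟩ := List.mem_map.mp hm
    exact hk ⟨h0, (lam.rowLen_anti 0 i (Nat.zero_le _)).trans h⟩

theorem jmap_ket {K : Type*} [Field K] [CharZero K] (t : K) {M₁ M₂ : ℕ} {lam mu : YoungDiagram}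
    (hl : lam.rowLen 0 ≤ M₁) (hm : mu.rowLen 0 ≤ M₂) :
    jmap t M₁ M₂ (ket K M₁ M₂ lam mu) = coupledQ t lam.rowLens mu.rowLens := by
  rw [jmap, ket, Finsupp.linearCombination_single, one_smul]
  simp only [occupation, Sum.elim_inl, Sum.elim_inr]
  rw [rowsOfOccupation_count hl, rowsOfOccupation_count hm]

end Image

end QBoson

theorem mainTheorem9 {K : Type*} [Field K] [CharZero K] (t : K) (M₁ M₂ N : ℕ) (u : Fin N → K)
    (hu_ne : ∀ j, u j ≠ 0) (hu_sq : ∀ i j, i ≠ j → u i ^ 2 ≠ u j ^ 2) :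
    QBoson.betheVector t M₁ M₂ u =
        ∑ k : Finset (Fin N), ∑ lam ∈ QBoson.box k.card M₁, ∑ mu ∈ QBoson.box N M₂,
          QBoson.coefficient t M₁ M₂ u k lam mu • QBoson.ket K M₁ M₂ lam mu ∧
      QBoson.jmap t M₁ M₂ (QBoson.betheVector t M₁ M₂ u) =
        ∑ k : Finset (Fin N), ∑ lam ∈ QBoson.box k.card M₁, ∑ mu ∈ QBoson.box N M₂,
          QBoson.coefficient t M₁ M₂ u k lam mu • QBoson.coupledQ t lam.rowLens mu.rowLens := by
  have h := QBoson.betheVector_eq t M₁ M₂ u hu_ne hu_sq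
  refine ⟨h, ?_⟩
  rw [h]
  simp only [map_sum, map_smul]
  refine Finset.sum_congr rfl fun k _ => Finset.sum_congr rfl fun lam hlam =>
    Finset.sum_congr rfl fun mu hmu => ?_
  rw [QBoson.jmap_ket t (QBoson.mem_box.mp hlam).2 (QBoson.mem_box.mp hmu).2]
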